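/- Let $H$ be a fixed finite simple graph having a connected component that contains at least two cycles, i.e. a component that is neither a tree nor unicyclic (a graph is unicyclic if it is connected and contains exactly one cycle); in particular, $H$ may be any connected finite graph that contains a cycle and is not unicyclic. A finite simple graph $G$ is an $H$-graph if there are a subdivision $H'$ of $H$ (a graph obtained by replacing edges of $H$ with induced paths) and an assignment of a nonempty connected subgraph of $H'$ to every vertex of $G$ such that two distinct vertices of $G$ are adjacent if and only if their subgraphs share a vertex; $G$ is a proper $H$-graph if, in addition, the assignment can be chosen such that no assigned subgraph properly contains another one. For a class $\mathcal{C}$ of finite graphs, the isomorphism problem for $\mathcal{C}$ is the (promise) problem of deciding, for two given graphs in $\mathcal{C}$ (written as adjacency matrices), whether they are isomorphic. It is GI-complete if it is reducible to the general graph isomorphism problem in polynomial time and the general graph isomorphism problem is reducible to it in polynomial time; here a reduction is a polynomial-time computable (by a Turing machine) map on pairs of graphs that maps instances to instances and preserves the answer. Then the isomorphism problem for the class of all proper $H$-graphs and the isomorphism problem for the class of all $H$-graphs are both GI-complete. -/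

import Mathlib

namespace HGraphs

/-! ### Subdivisions, unicyclic graphs and `H`-graphs -/

/-- The graph obtained from `H` by replacing every edge `e` with an induced path that has `len e`
new inner vertices (so `len e = 0` leaves `e` as it is). The new vertices of `e` are
`(e, 0), …, (e, len e - 1)`, listed from one end of `e` to the other; the end at which the list
starts is chosen arbitrarily. -/
def subdivide {W : Type*} (H : SimpleGraph W) (len : H.edgeSet → ℕ) :
    SimpleGraph (W ⊕ (Σ e : H.edgeSet, Fin (len e))) :=
  SimpleGraph.fromRel fun x y =>
    match x, y with
    | .inl a, .inl b => ∃ h : H.Adj a b, len ⟨s(a, b), h⟩ = 0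
    | .inl a, .inr ⟨e, i⟩ =>
        (a = (Quot.out e.1).1 ∧ i.val = 0) ∨ (a = (Quot.out e.1).2 ∧ i.val + 1 = len e)
    | .inr ⟨e, i⟩, .inr ⟨f, j⟩ => e = f ∧ i.val + 1 = j.val
    | .inr _, .inl _ => False

/-- A subgraph is a cycle if it consists of the vertices and edges of a closed walk without
repetitions. -/
def IsCycleSubgraph {W : Type*} {H : SimpleGraph W} (C : H.Subgraph) : Prop :=
  ∃ (v : W) (p : H.Walk v v), p.IsCycle ∧ p.toSubgraph = C

/-- A graph is unicyclic if it is connected and contains exactly one cycle. -/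
def IsUnicyclic {W : Type*} (H : SimpleGraph W) : Prop :=
  H.Connected ∧ ∃! C : H.Subgraph, IsCycleSubgraph C

/-- A `K`-representation of `G`: connected (in particular nonempty) subgraphs of `K`, one for each
vertex of `G`, such that distinct vertices are adjacent iff their subgraphs share a vertex. -/
structure Representation {V W : Type*} (G : SimpleGraph V) (K : SimpleGraph W) where
  toSubgraph : V → K.Subgraph
  connected : ∀ v, (toSubgraph v).Connected
  adj_iff : ∀ u v, u ≠ v → (G.Adj u v ↔ (toSubgraph u ⊓ toSubgraph v).verts.Nonempty)

/-- A representation is proper if no subgraph in it properly contains another one. -/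
def Representation.IsProper {V W : Type*} {G : SimpleGraph V} {K : SimpleGraph W}
    (R : Representation G K) : Prop :=
  ∀ u v, ¬ R.toSubgraph u < R.toSubgraph v

/-- `G` is an `H`-graph if it has a representation in some subdivision of `H`. -/
def IsHGraph {V W : Type*} (H : SimpleGraph W) (G : SimpleGraph V) : Prop :=
  ∃ len : H.edgeSet → ℕ, Nonempty (Representation G (subdivide H len))

/-- `G` is a proper `H`-graph if it has a proper representation in some subdivision of `H`. -/
def IsProperHGraph {V W : Type*} (H : SimpleGraph W) (G : SimpleGraph V) : Prop :=
  ∃ (len : H.edgeSet → ℕ) (R : Representation G (subdivide H len)), R.IsProper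

/-! ### Isomorphism problems and polynomial-time reductions -/

/-- A finite graph, as it is given to an algorithm: its vertices are `0, …, order - 1`. -/
structure FinGraph where
  order : ℕ
  graph : SimpleGraph (Fin order)

/-- The finite alphabet in which graphs are written down. -/
inductive Symbol
  | bit (b : Bool)
  | rowEnd
  | graphEnd

open Classical in
/-- A graph is written down as the rows of its adjacency matrix, each followed by `rowEnd`,
and then `graphEnd`. -/
noncomputable def encodeGraph (G : FinGraph) : List Symbol :=
  (List.finRange G.order).flatMap (fun i =>
    (List.finRange G.order).map (fun j => Symbol.bit (decide (G.graph.Adj i j))) ++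
      [Symbol.rowEnd]) ++ [Symbol.graphEnd]

/-- A pair of graphs is written down as the first graph followed by the second. -/
noncomputable def encodePair (p : FinGraph × FinGraph) : List Symbol :=
  encodeGraph p.1 ++ encodeGraph p.2

/-- A decision problem whose instances are pairs of graphs, with a promise: only the instances
with `promise` are ever asked about. -/
structure PairProblem where
  promise : FinGraph × FinGraph → Prop
  yes : FinGraph × FinGraph → Prop

/-- The isomorphism problem for a class of graphs: given two graphs in the class, decide whether
they are isomorphic. -/
def isoProblem (C : FinGraph → Prop) : PairProblem where
  promise p := C p.1 ∧ C p.2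
  yes p := Nonempty (p.1.graph ≃g p.2.graph)

/-- The graph isomorphism problem. -/
def graphIsomorphism : PairProblem := isoProblem fun _ => True

/-- `P` is (many-one) reducible to `Q` in polynomial time on a Turing machine. -/
def PolyTimeReducible (P Q : PairProblem) : Prop :=
  ∃ f : FinGraph × FinGraph → FinGraph × FinGraph,
    Nonempty (Turing.TM2ComputableInPolyTime encodePair encodePair f) ∧
    ∀ p, P.promise p → Q.promise (f p) ∧ (P.yes p ↔ Q.yes (f p))

/-- `P` is GI-complete if it is equivalent to the graph isomorphism problem under
polynomial-time reductions. -/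
def IsGIComplete (P : PairProblem) : Prop :=
  PolyTimeReducible P graphIsomorphism ∧ PolyTimeReducible graphIsomorphism P

end HGraphs

/-!
The problem for a class `C` of graphs reduces to graph isomorphism by the identity map, so the point
is the converse reduction. It maps a graph `G` on `n` vertices to its `gadget`, which is a proper
`H`-graph for every `H` in question, and from which `G` can be recovered up to isomorphism; hence
the same reduction serves for both classes.

The gadget has vertices `x i` and `y i` for every vertex `i` of `G`, a vertex `z i j` for every
ordered pair of adjacent vertices, and two vertices `z i i` for every vertex. Its non-adjacent pairs
are all `x i, y j`, and `z i j` with `x i` and with `y j`; in addition there are filler vertices,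
adjacent to everything.

*Representation* (`isProperHGraph_of_roles`). A connected graph that contains two cycles has two
edges `e` and `f` whose removal leaves it connected (`exists_two_edges_connected_deleteEdges`): if
removing an edge of a cycle leaves a tree, every cycle consists of that edge and of the path in the
tree between its ends, so there is only one. Subdivide `e` and `f` by `2 * n + 1` vertices each.
Then `x i` is the segment of length `n + 1` of `e` that starts at `i`, the vertex `y j` is the same
on `f`, and `z i j` is everything but these two segments. All segments of `e` have the same length
and overlap, so `x k` meets the complement of the segment of `x i` exactly if `k ≠ i`, and is never
contained in it; this makes the representation proper (`bag_inter_nonempty_iff`,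
`bag_eq_of_subset`).

*Recovery* (`nonempty_iso_of_gadget_iso`). The `x i` and `y i` are the vertices with at least three
non-neighbours. Of these, two non-adjacent ones with two common non-neighbours are `x i` and `y i`
for the same `i`, since there is at most one `z i j` if `i ≠ j`. So an isomorphism of gadgets
permutes these pairs, exchanging the letters `x` and `y` everywhere or nowhere, and `i ≠ j` are
adjacent in `G` if and only if `x i` and `y j` have a common non-neighbour.

*Running time* (`runs_graph`, `computableInPolyTimeReduction`). The vertices of the gadget are the
triples `(i, j, c)` with `c < 4`, so that its adjacency matrix is written by scanning the matrix of
`G` four times for each entry `(i, j)`. Only equality of indices matters besides the two entries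
concerned. The machine keeps on one stack a copy of the matrix in which the diagonal, the present
row and the present column are marked; then one scan of this stack is a row of the gadget's matrix
(`runs_row`), and moving the marks takes one more scan (`shiftCol_word`, `shiftRow_word`).
-/

namespace HGraphs

/-! ### Removing two edges -/

variable {V : Type*} {C : SimpleGraph V}

/-- A cycle through the edge `ab` of a graph which is acyclic without that edge runs through the
unique path of the remaining graph between the ends of the edge. -/
theorem toSubgraph_eq_of_isCycle [DecidableEq V] {a b : V} (hab : C.Adj a b)
    (hac : (C.deleteEdges {s(a, b)}).IsAcyclic)
    (q : (C.deleteEdges {s(a, b)}).Walk b a) (hq : q.IsPath)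
    {v : V} (p : C.Walk v v) (hp : p.IsCycle) :
    p.toSubgraph = (SimpleGraph.Walk.cons hab
      (q.mapLe (SimpleGraph.deleteEdges_le {s(a, b)}))).toSubgraph := by
  have key : ∀ {u : V} (h : C.Adj a u) (r : C.Walk u a), (SimpleGraph.Walk.cons h r).IsCycle →
      u = b → (SimpleGraph.Walk.cons h r).toSubgraph = (SimpleGraph.Walk.cons hab
      (q.mapLe (SimpleGraph.deleteEdges_le {s(a, b)}))).toSubgraph := by
    rintro u h r hr rfl
    rw [SimpleGraph.Walk.cons_isCycle_iff] at hr
    have hmem : ∀ e ∈ r.edges, e ∈ (C.deleteEdges {s(a, u)}).edgeSet := by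
      intro e he
      rw [SimpleGraph.edgeSet_deleteEdges]
      exact ⟨r.edges_subset_edgeSet he, fun h' => hr.2 (by rwa [← Set.mem_singleton_iff.1 h'])⟩
    have h1 : r.transfer _ hmem = q := congrArg Subtype.val
      ((hac.subsingleton_path u a).elim ⟨r.transfer _ hmem, hr.1.transfer hmem⟩ ⟨q, hq⟩)
    have h2 : r = q.mapLe (SimpleGraph.deleteEdges_le {s(a, u)}) := by
      rw [← h1]
      simp only [SimpleGraph.Walk.mapLe]
      rw [← SimpleGraph.Walk.transfer_eq_map_ofLE _ _, SimpleGraph.Walk.transfer_transfer,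
        SimpleGraph.Walk.transfer_self]
      intro e he
      rw [SimpleGraph.Walk.edges_transfer] at he
      exact r.edges_subset_edgeSet he
    rw [h2]
  have he : s(a, b) ∈ p.edges := by
    by_contra hne
    have hmem : ∀ e ∈ p.edges, e ∈ (C.deleteEdges {s(a, b)}).edgeSet := by
      intro e he
      rw [SimpleGraph.edgeSet_deleteEdges]
      exact ⟨p.edges_subset_edgeSet he, fun h' => hne (by rwa [← Set.mem_singleton_iff.1 h'])⟩
    exact hac _ (hp.transfer hmem)
  have ha : a ∈ p.support := SimpleGraph.Walk.fst_mem_support_of_mem_edges p he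
  have hp' : (p.rotate a ha).IsCycle := hp.rotate ha
  have he' : s(a, b) ∈ (p.rotate a ha).edges := (p.rotate_edges a ha).mem_iff.2 he
  rw [← SimpleGraph.Walk.toSubgraph_rotate p ha]
  generalize p.rotate a ha = w at hp' he'
  cases w with
  | nil => simp at he'
  | @cons _ u _ h r =>
    by_cases hb : u = b
    · exact key h r hp' hb
    · -- The edge is the last one of the cycle: reverse the cycle.
      have hr := (SimpleGraph.Walk.cons_isCycle_iff _ _).1 hp'
      rw [SimpleGraph.Walk.edges_cons, List.mem_cons] at he'
      have he'' : s(a, b) ∈ r.edges := by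
        refine he'.resolve_left fun h' => hb ?_
        rcases Sym2.eq_iff.1 h' with h' | h'
        · exact h'.2.symm
        · exact absurd h'.2.symm hab.ne
      have hpen := hr.1.eq_penultimate_of_mem_edges he''
      have hnil : ¬ r.Nil := SimpleGraph.Walk.not_nil_of_ne h.ne'
      rw [← SimpleGraph.Walk.toSubgraph_reverse]
      have hp'' := hp'.reverse
      have hsnd : (SimpleGraph.Walk.cons h r).reverse.snd = b := by
        rw [SimpleGraph.Walk.snd_reverse,
          SimpleGraph.Walk.penultimate_cons_of_not_nil _ _ hnil, hpen]
      generalize (SimpleGraph.Walk.cons h r).reverse = w' at hp'' hsnd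
      cases w' with
      | nil => exact absurd hsnd hab.ne
      | cons h r => exact key h r hp'' (by simpa using hsnd)

theorem isUnicyclic_of_deleteEdges_isAcyclic (hC : C.Connected) {a b : V} (hab : C.Adj a b)
    (hconn : (C.deleteEdges {s(a, b)}).Connected)
    (hac : (C.deleteEdges {s(a, b)}).IsAcyclic) : IsUnicyclic C := by
  classical
  obtain ⟨q, hq⟩ := (hconn b a).exists_isPath
  refine ⟨hC, _, ⟨a, .cons hab (q.mapLe (SimpleGraph.deleteEdges_le {s(a, b)})), ?_, rfl⟩, ?_⟩
  · rw [SimpleGraph.Walk.cons_isCycle_iff]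
    refine ⟨(SimpleGraph.Walk.isPath_mapLe _).2 hq, fun h => ?_⟩
    rw [SimpleGraph.Walk.edges_mapLe_eq_edges] at h
    have := q.edges_subset_edgeSet h
    simp at this
  · rintro D ⟨v, p, hp, rfl⟩
    exact toSubgraph_eq_of_isCycle hab hac q hq p hp

/-- An edge on a cycle can be removed without disconnecting the graph. -/
theorem exists_connected_deleteEdges_of_not_isAcyclic (hC : C.Connected) (h : ¬ C.IsAcyclic) :
    ∃ a b, C.Adj a b ∧ (C.deleteEdges {s(a, b)}).Connected := by
  rw [SimpleGraph.isAcyclic_iff_forall_adj_isBridge] at h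
  push Not at h
  obtain ⟨a, b, hab, hb⟩ := h
  refine ⟨a, b, hab, ?_⟩
  have := hC.connected_delete_edge_of_not_isBridge hb
  simpa [SimpleGraph.deleteEdges] using this

theorem exists_two_edges_connected_deleteEdges (hC : C.Connected) (h : ¬ C.IsAcyclic)
    (h' : ¬ IsUnicyclic C) :
    ∃ e f, e ∈ C.edgeSet ∧ f ∈ C.edgeSet ∧ e ≠ f ∧ (C.deleteEdges {e, f}).Connected := by
  obtain ⟨a, b, hab, hconn⟩ := exists_connected_deleteEdges_of_not_isAcyclic hC h
  have hac : ¬ (C.deleteEdges {s(a, b)}).IsAcyclic :=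
    fun hac => h' (isUnicyclic_of_deleteEdges_isAcyclic hC hab hconn hac)
  obtain ⟨x, y, hxy, hconn'⟩ := exists_connected_deleteEdges_of_not_isAcyclic hconn hac
  rw [SimpleGraph.deleteEdges_adj] at hxy
  refine ⟨s(a, b), s(x, y), hab, hxy.1, fun he => hxy.2 he.symm, ?_⟩
  rwa [SimpleGraph.deleteEdges_deleteEdges, Set.singleton_union] at hconn'

/-- Two edges can be removed from a component that is neither acyclic nor unicyclic without
disconnecting it. -/
theorem exists_two_edges_connected_induce {W : Type*} (H : SimpleGraph W) (c : H.ConnectedComponent)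
    (h : ¬ c.toSimpleGraph.IsAcyclic) (h' : ¬ IsUnicyclic c.toSimpleGraph) :
    ∃ (S : Set W) (e f : H.edgeSet), e ≠ f ∧ (∀ w ∈ e.1, w ∈ S) ∧ (∀ w ∈ f.1, w ∈ S) ∧
      ((H.deleteEdges {e.1, f.1}).induce S).Connected := by
  obtain ⟨e, f, he, hf, hef, hc⟩ :=
    exists_two_edges_connected_deleteEdges c.connected_toSimpleGraph h h'
  have hinj : Function.Injective (Sym2.map (Subtype.val : c → W)) :=
    Sym2.map.injective Subtype.val_injective
  have hedge : ∀ g ∈ c.toSimpleGraph.edgeSet, Sym2.map (Subtype.val : c → W) g ∈ H.edgeSet := by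
    intro g
    induction g with | _ a b => exact fun hg => hg
  have hmem : ∀ (g : Sym2 c), ∀ w ∈ Sym2.map (Subtype.val : c → W) g, w ∈ c.supp := by
    intro g w hw
    obtain ⟨a, -, rfl⟩ := Sym2.mem_map.1 hw
    exact a.2
  refine ⟨c.supp, ⟨_, hedge e he⟩, ⟨_, hedge f hf⟩,
    fun hEq => hef (hinj (congrArg Subtype.val hEq)),
    hmem e, hmem f, ?_⟩
  have hEq : (H.deleteEdges {Sym2.map Subtype.val e, Sym2.map Subtype.val f}).induce c.supp =
      c.toSimpleGraph.deleteEdges {e, f} := by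
    ext a b
    have hab : s(a.1, b.1) = Sym2.map (Subtype.val : c → W) s(a, b) := rfl
    rw [SimpleGraph.comap_adj, SimpleGraph.deleteEdges_adj, SimpleGraph.deleteEdges_adj]
    simp only [Function.Embedding.subtype_apply, Set.mem_insert_iff, Set.mem_singleton_iff, hab,
      hinj.eq_iff]
    rfl
  exact hEq ▸ hc

/-! ### The representation -/

/-- The roles of the vertices of the graphs that encode graphs on `n` vertices: `x i` and `y i`
both stand for the vertex `i`, and `z i j` stands for the pair `(i, j)`. The additional index `n`
does not belong to a vertex, so that vertices with role `z n n` encode nothing. -/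
inductive Role (n : ℕ)
  | x (i : Fin (n + 1))
  | y (j : Fin (n + 1))
  | z (i j : Fin (n + 1))

/-- Distinct vertices with these roles are not adjacent. -/
def Role.Miss {n : ℕ} : Role n → Role n → Prop
  | x _, y _ => True
  | y _, x _ => True
  | x i, z k _ => i = k
  | z k _, x i => i = k
  | y j, z _ l => j = l
  | z _ l, y j => j = l
  | _, _ => False

theorem Role.Miss.symm {n : ℕ} {a b : Role n} (h : a.Miss b) : b.Miss a := by
  cases a <;> cases b <;> exact h

section Subdivide

variable {W : Type*} {H : SimpleGraph W} {len : H.edgeSet → ℕ} {n : ℕ}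

theorem subdivide_adj_inl {a b : W} (h : H.Adj a b) (hl : len ⟨s(a, b), h⟩ = 0) :
    (subdivide H len).Adj (.inl a) (.inl b) := by
  rw [subdivide, SimpleGraph.fromRel_adj]
  exact ⟨fun hab => h.ne (Sum.inl_injective hab), .inl ⟨h, hl⟩⟩

theorem subdivide_adj_inl_first (e : H.edgeSet) (h : 0 < len e) :
    (subdivide H len).Adj (.inl (Quot.out e.1).1) (.inr ⟨e, ⟨0, h⟩⟩) := by
  rw [subdivide, SimpleGraph.fromRel_adj]
  exact ⟨Sum.inl_ne_inr, .inl (.inl ⟨rfl, rfl⟩)⟩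

theorem subdivide_adj_inl_last (e : H.edgeSet) {t : ℕ} (h : t < len e) (ht : t + 1 = len e) :
    (subdivide H len).Adj (.inl (Quot.out e.1).2) (.inr ⟨e, ⟨t, h⟩⟩) := by
  rw [subdivide, SimpleGraph.fromRel_adj]
  exact ⟨Sum.inl_ne_inr, .inl (.inr ⟨rfl, ht⟩)⟩

theorem subdivide_adj_inr (e : H.edgeSet) {t : ℕ} (h : t + 1 < len e) :
    (subdivide H len).Adj (.inr ⟨e, ⟨t, (Nat.lt_succ_self t).trans h⟩⟩) (.inr ⟨e, ⟨t + 1, h⟩⟩) := by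
  rw [subdivide, SimpleGraph.fromRel_adj]
  refine ⟨fun hEq => ?_, .inl ⟨rfl, rfl⟩⟩
  have := Sum.inr_injective hEq
  simp at this

/-- A segment of a subdivided edge is connected. -/
theorem reachable_induce_segment (e : H.edgeSet) (s : Set (W ⊕ (Σ e : H.edgeSet, Fin (len e))))
    {a b : ℕ} (hab : a ≤ b) (hb : b < len e)
    (hs : ∀ t (h : t < len e), a ≤ t → t ≤ b → .inr ⟨e, ⟨t, h⟩⟩ ∈ s) :
    ((subdivide H len).induce s).Reachable
      ⟨.inr ⟨e, ⟨a, hab.trans_lt hb⟩⟩, hs a _ le_rfl hab⟩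
      ⟨.inr ⟨e, ⟨b, hb⟩⟩, hs b _ hab le_rfl⟩ := by
  induction b, hab using Nat.le_induction with
  | base => exact .refl _
  | succ b hab ih =>
    refine (ih (by lia) fun t h h1 h2 => hs t h h1 (by lia)).trans (SimpleGraph.Adj.reachable ?_)
    exact subdivide_adj_inr e hb

/-- The bags of the representation. The edges `e` and `f` are subdivided by `2 * n + 1` inner
vertices. The bag of `x i` is the segment of `n + 1` inner vertices of `e` that starts at `i`,
that of `y j` is the one of `f` that starts at `j`, and the bag of `z i j` is all of `S`, `e` and
`f` except these two segments. -/
def bag (len : H.edgeSet → ℕ) (n : ℕ) (S : Set W) (e f : H.edgeSet) :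
    Role n → Set (W ⊕ (Σ e : H.edgeSet, Fin (len e)))
  | .x i => {v | match v with
      | .inl _ => False
      | .inr ⟨g, t⟩ => g = e ∧ i.val ≤ t.val ∧ t.val ≤ i.val + n}
  | .y j => {v | match v with
      | .inl _ => False
      | .inr ⟨g, t⟩ => g = f ∧ j.val ≤ t.val ∧ t.val ≤ j.val + n}
  | .z i j => {v | match v with
      | .inl w => w ∈ S
      | .inr ⟨g, t⟩ => (g = e ∧ (t.val < i.val ∨ i.val + n < t.val)) ∨
          (g = f ∧ (t.val < j.val ∨ j.val + n < t.val))}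

variable {S : Set W} {e f : H.edgeSet}

theorem bag_inter_nonempty_iff (hS : S.Nonempty) (hef : e ≠ f) (he : len e = 2 * n + 1)
    (hf : len f = 2 * n + 1) (a b : Role n) :
    (bag len n S e f a ∩ bag len n S e f b).Nonempty ↔ ¬ a.Miss b := by
  have hxz : ∀ i k l : Fin (n + 1), (bag len n S e f (.x i) ∩ bag len n S e f (.z k l)).Nonempty ↔
      ¬ i = k := by
    intro i k l
    constructor
    · rintro ⟨w | ⟨g, t⟩, h1, h2⟩ rfl
      · exact h1
      · obtain ⟨rfl, h3, h4⟩ := h1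
        rcases h2 with ⟨-, h2⟩ | ⟨h2, -⟩
        · lia
        · exact hef h2
    · intro hik
      rcases lt_or_gt_of_ne (fun h => hik (Fin.ext h)) with h | h
      · exact ⟨.inr ⟨e, ⟨i, by lia⟩⟩, ⟨rfl, by simp, by simp⟩, .inl ⟨rfl, .inl h⟩⟩
      · exact ⟨.inr ⟨e, ⟨i + n, by lia⟩⟩, ⟨rfl, by simp, by simp⟩,
          .inl ⟨rfl, .inr (by simpa using h)⟩⟩
  have hyz : ∀ j k l : Fin (n + 1), (bag len n S e f (.y j) ∩ bag len n S e f (.z k l)).Nonempty ↔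
      ¬ j = l := by
    intro j k l
    constructor
    · rintro ⟨w | ⟨g, t⟩, h1, h2⟩ rfl
      · exact h1
      · obtain ⟨rfl, h3, h4⟩ := h1
        rcases h2 with ⟨h2, -⟩ | ⟨-, h2⟩
        · exact hef h2.symm
        · lia
    · intro hik
      rcases lt_or_gt_of_ne (fun h => hik (Fin.ext h)) with h | h
      · exact ⟨.inr ⟨f, ⟨j, by lia⟩⟩, ⟨rfl, by simp, by simp⟩, .inr ⟨rfl, .inl h⟩⟩
      · exact ⟨.inr ⟨f, ⟨j + n, by lia⟩⟩, ⟨rfl, by simp, by simp⟩,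
          .inr ⟨rfl, .inr (by simpa using h)⟩⟩
  have hxy : ∀ i j : Fin (n + 1), ¬ (bag len n S e f (.x i) ∩ bag len n S e f (.y j)).Nonempty := by
    rintro i j ⟨w | ⟨g, t⟩, h1, h2⟩
    · exact h1
    · exact hef (h1.1.symm.trans h2.1)
  cases a with
  | x i =>
    cases b with
    | x k =>
      refine iff_of_true ⟨.inr ⟨e, ⟨n, by lia⟩⟩, ⟨rfl, ?_, ?_⟩, ⟨rfl, ?_, ?_⟩⟩ id <;> simp <;> lia
    | y l => exact iff_of_false (hxy i l) (fun h => h trivial)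
    | z k l => exact hxz i k l
  | y j =>
    cases b with
    | x k => exact iff_of_false (by rw [Set.inter_comm]; exact hxy k j) (fun h => h trivial)
    | y l =>
      refine iff_of_true ⟨.inr ⟨f, ⟨n, by lia⟩⟩, ⟨rfl, ?_, ?_⟩, ⟨rfl, ?_, ?_⟩⟩ id <;> simp <;> lia
    | z k l => exact hyz j k l
  | z i j =>
    cases b with
    | x k => rw [Set.inter_comm]; exact hxz k i j
    | y l => rw [Set.inter_comm]; exact hyz l i j
    | z k l =>
      obtain ⟨w, hw⟩ := hS
      exact iff_of_true ⟨.inl w, hw, hw⟩ id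

/-- No bag properly contains another one. -/
theorem bag_eq_of_subset (hS : S.Nonempty) (hef : e ≠ f) (he : len e = 2 * n + 1)
    (hf : len f = 2 * n + 1) {a b : Role n} (h : bag len n S e f a ⊆ bag len n S e f b) :
    a = b := by
  cases a with
  | x i =>
    have h0 := @h (.inr ⟨e, ⟨i, by lia⟩⟩) ⟨rfl, by simp, by simp⟩
    have h1 := @h (.inr ⟨e, ⟨i + n, by lia⟩⟩) ⟨rfl, by simp, by simp⟩
    have h2 := @h (.inr ⟨e, ⟨n, by lia⟩⟩) ⟨rfl, by simp; lia, by simp⟩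
    cases b with
    | x k =>
      have h3 := h0.2
      have h4 := h1.2
      simp only at h3 h4
      rw [Fin.ext (show i.val = k.val by lia)]
    | y l => exact absurd h0.1 hef
    | z k l =>
      rcases h2 with h2 | h2
      · have h3 := h2.2
        simp only at h3
        lia
      · exact absurd h2.1 hef
  | y j =>
    have h0 := @h (.inr ⟨f, ⟨j, by lia⟩⟩) ⟨rfl, by simp, by simp⟩
    have h1 := @h (.inr ⟨f, ⟨j + n, by lia⟩⟩) ⟨rfl, by simp, by simp⟩
    have h2 := @h (.inr ⟨f, ⟨n, by lia⟩⟩) ⟨rfl, by simp; lia, by simp⟩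
    cases b with
    | x k => exact absurd h0.1 hef.symm
    | y l =>
      have h3 := h0.2
      have h4 := h1.2
      simp only at h3 h4
      rw [Fin.ext (show j.val = l.val by lia)]
    | z k l =>
      rcases h2 with h2 | h2
      · exact absurd h2.1 hef.symm
      · have h3 := h2.2
        simp only at h3
        lia
  | z i j =>
    obtain ⟨w, hw⟩ := hS
    cases b with
    | x k => exact (@h (.inl w) hw).elim
    | y l => exact (@h (.inl w) hw).elim
    | z k l =>
      have hi : i = k := by
        by_contra hne
        obtain ⟨v, hv1, hv2⟩ := (bag_inter_nonempty_iff ⟨w, hw⟩ hef he hf (.x k) (.z i j)).2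
          (fun h => hne (Eq.symm h))
        exact (bag_inter_nonempty_iff ⟨w, hw⟩ hef he hf (.x k) (.z k l)).1 ⟨v, hv1, h hv2⟩ rfl
      have hj : j = l := by
        by_contra hne
        obtain ⟨v, hv1, hv2⟩ := (bag_inter_nonempty_iff ⟨w, hw⟩ hef he hf (.y l) (.z i j)).2
          (fun h => hne (Eq.symm h))
        exact (bag_inter_nonempty_iff ⟨w, hw⟩ hef he hf (.y l) (.z k l)).1 ⟨v, hv1, h hv2⟩ rfl
      rw [hi, hj]

theorem connected_induce_segment (e : H.edgeSet) (s : Set (W ⊕ (Σ e : H.edgeSet, Fin (len e))))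
    {a b : ℕ} (hab : a ≤ b) (hb : b < len e)
    (hs : ∀ v, v ∈ s ↔ ∃ t, ∃ h : t < len e, a ≤ t ∧ t ≤ b ∧ v = .inr ⟨e, ⟨t, h⟩⟩) :
    ((subdivide H len).induce s).Connected := by
  have ha : .inr ⟨e, ⟨a, hab.trans_lt hb⟩⟩ ∈ s := (hs _).2 ⟨a, _, le_rfl, hab, rfl⟩
  rw [SimpleGraph.connected_iff_exists_forall_reachable]
  refine ⟨⟨_, ha⟩, ?_⟩
  rintro ⟨v, hv⟩
  obtain ⟨t, h, h1, h2, rfl⟩ := (hs v).1 hv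
  exact reachable_induce_segment e s h1 h
    fun t' h' h1' h2' => (hs _).2 ⟨t', h', h1', h2'.trans h2, rfl⟩

theorem connected_induce_bag (hef : e ≠ f) (he : len e = 2 * n + 1)
    (hf : len f = 2 * n + 1) (h0 : ∀ g, g ≠ e → g ≠ f → len g = 0)
    (heS : ∀ w ∈ e.1, w ∈ S) (hfS : ∀ w ∈ f.1, w ∈ S)
    (hconn : ((H.deleteEdges {e.1, f.1}).induce S).Connected) (a : Role n) :
    ((subdivide H len).induce (bag len n S e f a)).Connected := by
  cases a with
  | x i =>
    refine connected_induce_segment e _ (Nat.le_add_right i.val n) (by lia) ?_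
    rintro (w | ⟨g, t⟩)
    · exact iff_of_false id (by simp)
    · constructor
      · rintro ⟨rfl, h1, h2⟩
        exact ⟨t, t.2, h1, h2, rfl⟩
      · rintro ⟨t', h, h1, h2, h3⟩
        cases h3
        exact ⟨rfl, h1, h2⟩
  | y i =>
    refine connected_induce_segment f _ (Nat.le_add_right i.val n) (by lia) ?_
    rintro (w | ⟨g, t⟩)
    · exact iff_of_false id (by simp)
    · constructor
      · rintro ⟨rfl, h1, h2⟩
        exact ⟨t, t.2, h1, h2, rfl⟩
      · rintro ⟨t', h, h1, h2, h3⟩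
        cases h3
        exact ⟨rfl, h1, h2⟩
  | z i j =>
    set s := bag len n S e f (.z i j) with hs
    have hin : ∀ {w}, w ∈ S → .inl w ∈ s := fun hw => hw
    have hfst : ∀ g : Sym2 W, (Quot.out g).1 ∈ g := fun g => Sym2.out_fst_mem g
    have hsnd : ∀ g : Sym2 W, (Quot.out g).2 ∈ g := fun g => Sym2.out_snd_mem g
    -- Two vertices of `S` are connected within `S`, avoiding `e` and `f`.
    have hSS : ∀ u v : S, ((subdivide H len).induce s).Reachable
        ⟨.inl u.1, hin u.2⟩ ⟨.inl v.1, hin v.2⟩ := by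
      intro u v
      let φ : (H.deleteEdges {e.1, f.1}).induce S →g (subdivide H len).induce s :=
        { toFun := fun u => ⟨.inl u.1, hin u.2⟩
          map_rel' := by
            intro a b hab
            have hab' := (SimpleGraph.deleteEdges_adj.1 hab)
            refine subdivide_adj_inl hab'.1 (h0 _ ?_ ?_)
            · exact fun hE => hab'.2 (.inl (congrArg Subtype.val hE))
            · exact fun hE => hab'.2 (.inr (congrArg Subtype.val hE)) }
      exact (hconn u v).map φ
    -- The two remaining parts of a subdivided edge hang on the ends of the edge.
    have hside : ∀ (g : H.edgeSet) (k : ℕ), len g = 2 * n + 1 → (∀ w ∈ g.1, w ∈ S) →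
        (∀ t (h : t < len g), t < k ∨ k + n < t → .inr ⟨g, ⟨t, h⟩⟩ ∈ s) →
        ∀ t (h : t < len g) (ht : t < k ∨ k + n < t) (hm : .inr ⟨g, ⟨t, h⟩⟩ ∈ s), ∃ u : S,
        ((subdivide H len).induce s).Reachable ⟨.inl u.1, hin u.2⟩ ⟨.inr ⟨g, ⟨t, h⟩⟩, hm⟩ := by
      intro g k hg hgS hgs t h ht hm
      rcases ht with ht | ht
      · refine ⟨⟨_, hgS _ (hfst g.1)⟩, SimpleGraph.Reachable.trans (SimpleGraph.Adj.reachable ?_)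
          (reachable_induce_segment g s (Nat.zero_le t) h
            fun t' h' _ h2 => hgs t' h' (.inl (by lia)))⟩
        exact subdivide_adj_inl_first g _
      · refine ⟨⟨_, hgS _ (hsnd g.1)⟩, SimpleGraph.Reachable.trans (SimpleGraph.Adj.reachable ?_)
          (reachable_induce_segment g s (show t ≤ 2 * n by lia) (by lia)
            fun t' h' h1 _ => hgs t' h' (.inr (by lia))).symm⟩
        exact subdivide_adj_inl_last g _ hg.symm
    have hall : ∀ v : s, ∃ u : S, ((subdivide H len).induce s).Reachable ⟨.inl u.1, hin u.2⟩ v := by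
      rintro ⟨w | ⟨g, t⟩, hv⟩
      · exact ⟨⟨w, hv⟩, .refl _⟩
      · rcases id hv with ⟨rfl, h⟩ | ⟨rfl, h⟩
        · exact hside g i he heS (fun t h ht => .inl ⟨rfl, ht⟩) t.1 t.2 h hv
        · exact hside g j hf hfS (fun t h ht => .inr ⟨rfl, ht⟩) t.1 t.2 h hv
    obtain ⟨w⟩ := hconn.nonempty
    rw [SimpleGraph.connected_iff_exists_forall_reachable]
    refine ⟨⟨.inl w.1, hin w.2⟩, fun v => ?_⟩
    obtain ⟨u, hu⟩ := hall v
    exact (hSS w u).trans hu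

end Subdivide

/-- A graph in which adjacency is ruled by roles is a proper `H`-graph, for every `H` that has two
edges whose removal leaves some connected part containing their ends. -/
theorem isProperHGraph_of_roles {V W : Type*} {H : SimpleGraph W} {S : Set W} {e f : H.edgeSet}
    (hef : e ≠ f) (heS : ∀ w ∈ e.1, w ∈ S) (hfS : ∀ w ∈ f.1, w ∈ S)
    (hconn : ((H.deleteEdges {e.1, f.1}).induce S).Connected)
    {n : ℕ} (role : V → Role n) {G : SimpleGraph V}
    (hG : ∀ u v, G.Adj u v ↔ u ≠ v ∧ ¬ (role u).Miss (role v)) : IsProperHGraph H G := by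
  classical
  let len : H.edgeSet → ℕ := fun g => if g = e ∨ g = f then 2 * n + 1 else 0
  have he : len e = 2 * n + 1 := if_pos (.inl rfl)
  have hf : len f = 2 * n + 1 := if_pos (.inr rfl)
  have hS : S.Nonempty := Set.nonempty_coe_sort.1 hconn.nonempty
  refine ⟨len,
    { toSubgraph := fun v => (⊤ : (subdivide H len).Subgraph).induce (bag len n S e f (role v))
      connected := fun v => ?_
      adj_iff := fun u v huv => ?_ }, fun u v huv => ?_⟩
  · rw [← SimpleGraph.connected_induce_iff]
    exact connected_induce_bag hef he hf (fun g h1 h2 => if_neg (by simp [h1, h2])) heS hfS hconn _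
  · rw [hG, and_iff_right huv, ← bag_inter_nonempty_iff hS hef he hf]
    rfl
  · have hsub : bag len n S e f (role u) ⊆ bag len n S e f (role v) :=
      huv.le.1
    have := bag_eq_of_subset hS hef he hf hsub
    simp [this] at huv

/-! ### The gadget, and recovering a graph from it -/

section Gadget

variable {n : ℕ}

open Classical in
/-- The roles of the vertices of the graph that encodes `G`: the pair `(i, i)` carries a vertex
with role `x i`, one with role `y i` and two with role `z i i`, a pair of adjacent vertices `(i, j)`
carries one with role `z i j`. All other triples are fillers with role `z n n`. -/
noncomputable def role (G : SimpleGraph (Fin n)) : Fin n × Fin n × Fin 4 → Role n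
  | (i, j, 0) => if i = j then .x i.castSucc else .z (Fin.last n) (Fin.last n)
  | (i, j, 1) => if i = j then .y i.castSucc else .z (Fin.last n) (Fin.last n)
  | (i, j, 2) => if i = j ∨ G.Adj i j then .z i.castSucc j.castSucc
      else .z (Fin.last n) (Fin.last n)
  | (i, j, 3) => if i = j then .z i.castSucc j.castSucc else .z (Fin.last n) (Fin.last n)

/-- The graph that encodes `G` and is a proper `H`-graph whatever `G` is. -/
def gadget (G : SimpleGraph (Fin n)) : SimpleGraph (Fin n × Fin n × Fin 4) where
  Adj u v := u ≠ v ∧ ¬ (role G u).Miss (role G v)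
  symm := ⟨fun _ _ h => ⟨h.1.symm, fun h' => h.2 h'.symm⟩⟩
  loopless := ⟨fun _ h => h.1 rfl⟩

/-- Two vertices of the gadget are distinct and not adjacent. -/
def Missing (G : SimpleGraph (Fin n)) (u v : Fin n × Fin n × Fin 4) : Prop :=
  (role G u).Miss (role G v)

theorem missing_iff (G : SimpleGraph (Fin n)) (u v) :
    Missing G u v ↔ u ≠ v ∧ ¬ (gadget G).Adj u v := by
  have : ¬ Missing G u u := by
    unfold Missing
    cases role G u <;> exact id
  constructor
  · intro h
    exact ⟨fun huv => this (huv ▸ h), fun h' => h'.2 h⟩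
  · rintro ⟨h1, h2⟩
    by_contra h
    exact h2 ⟨h1, h⟩

theorem missing_x_iff (G : SimpleGraph (Fin n)) (i : Fin n) (v) :
    Missing G (i, i, 0) v ↔ (∃ k, v = (k, k, 1)) ∨ (∃ j, (i = j ∨ G.Adj i j) ∧ v = (i, j, 2)) ∨
      v = (i, i, 3) := by
  obtain ⟨k, l, c⟩ := v
  fin_cases c <;> simp only [Missing, role] <;> split_ifs <;>
    simp_all [Role.Miss, Fin.castSucc_ne_last] <;> grind

theorem missing_y_iff (G : SimpleGraph (Fin n)) (j : Fin n) (v) :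
    Missing G (j, j, 1) v ↔ (∃ k, v = (k, k, 0)) ∨ (∃ i, (i = j ∨ G.Adj i j) ∧ v = (i, j, 2)) ∨
      v = (j, j, 3) := by
  obtain ⟨k, l, c⟩ := v
  fin_cases c <;> simp only [Missing, role] <;> split_ifs <;>
    simp_all [Role.Miss, Fin.castSucc_ne_last] <;> grind

/-- The vertices with at least three non-neighbours are those with a role `x i` or `y i`. -/
theorem exists_three_missing_iff (G : SimpleGraph (Fin n)) (u) :
    (∃ a b c, a ≠ b ∧ a ≠ c ∧ b ≠ c ∧ Missing G u a ∧ Missing G u b ∧ Missing G u c) ↔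
      ∃ i, u = (i, i, 0) ∨ u = (i, i, 1) := by
  constructor
  · rintro ⟨a, b, c, hab, hac, hbc, ha, hb, hc⟩
    by_contra hu
    -- A vertex with role `z i j` misses only the vertices with the roles `x i` and `y j`.
    obtain ⟨k, l, hkl⟩ : ∃ k l, role G u = .z k l := by
      obtain ⟨k, l, d⟩ := u
      fin_cases d <;> simp only [role] <;> split_ifs <;> simp_all
    have h2 : ∀ v, Missing G u v →
        ∃ i : Fin n, (v = (i, i, 0) ∧ i.castSucc = k) ∨ (v = (i, i, 1) ∧ i.castSucc = l) := by
      rintro ⟨i, j, d⟩ hv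
      rw [Missing, hkl] at hv
      fin_cases d <;> simp only [role] at hv ⊢ <;> split_ifs at hv <;> simp_all [Role.Miss]
    obtain ⟨i, hi⟩ := h2 a ha
    obtain ⟨i', hi'⟩ := h2 b hb
    obtain ⟨i'', hi''⟩ := h2 c hc
    grind [Fin.castSucc_inj]
  · rintro ⟨i, rfl | rfl⟩
    · refine ⟨(i, i, 1), (i, i, 2), (i, i, 3), by simp, by simp, by simp, ?_, ?_, ?_⟩ <;>
        rw [missing_x_iff] <;> simp
    · refine ⟨(i, i, 0), (i, i, 2), (i, i, 3), by simp, by simp, by simp, ?_, ?_, ?_⟩ <;>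
        rw [missing_y_iff] <;> simp

/-- The vertices `u` and `v` have the roles `x i` and `y i` for some `i`. They are recognized by
having many non-neighbours each and more than one in common, besides being not adjacent. -/
theorem twin_iff (G : SimpleGraph (Fin n)) (u v) :
    ((∃ a b c, a ≠ b ∧ a ≠ c ∧ b ≠ c ∧ Missing G u a ∧ Missing G u b ∧ Missing G u c) ∧
      (∃ a b c, a ≠ b ∧ a ≠ c ∧ b ≠ c ∧ Missing G v a ∧ Missing G v b ∧ Missing G v c) ∧
      Missing G u v ∧
      ∃ a b, a ≠ b ∧ Missing G u a ∧ Missing G v a ∧ Missing G u b ∧ Missing G v b) ↔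
    ∃ i, (u = (i, i, 0) ∧ v = (i, i, 1)) ∨ (u = (i, i, 1) ∧ v = (i, i, 0)) := by
  rw [exists_three_missing_iff, exists_three_missing_iff]
  constructor
  · rintro ⟨⟨i, rfl | rfl⟩, ⟨k, rfl | rfl⟩, huv, a, b, hab, h1, h2, h3, h4⟩
    · simp [missing_x_iff] at huv
    · rw [missing_x_iff] at h1 h3
      rw [missing_y_iff] at h2 h4
      grind
    · rw [missing_y_iff] at h1 h3
      rw [missing_x_iff] at h2 h4
      grind
    · simp [missing_y_iff] at huv
  · rintro ⟨i, ⟨rfl, rfl⟩ | ⟨rfl, rfl⟩⟩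
    · refine ⟨⟨i, .inl rfl⟩, ⟨i, .inr rfl⟩, ?_, (i, i, 2), (i, i, 3), by simp, ?_⟩ <;>
        simp [missing_x_iff, missing_y_iff]
    · refine ⟨⟨i, .inr rfl⟩, ⟨i, .inl rfl⟩, ?_, (i, i, 2), (i, i, 3), by simp, ?_⟩ <;>
        simp [missing_x_iff, missing_y_iff]

theorem adj_iff_exists_missing (G : SimpleGraph (Fin n)) {i j : Fin n} (hij : i ≠ j) :
    G.Adj i j ↔ ∃ a, Missing G (i, i, 0) a ∧ Missing G (j, j, 1) a := by
  constructor
  · intro h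
    exact ⟨(i, j, 2), by simp [missing_x_iff, h], by simp [missing_y_iff, h]⟩
  · rintro ⟨a, h1, h2⟩
    rw [missing_x_iff] at h1
    rw [missing_y_iff] at h2
    grind

/-- The encoded graph can be recovered from its gadget. -/
theorem nonempty_iso_of_gadget_iso {m : ℕ} {G : SimpleGraph (Fin n)} {G' : SimpleGraph (Fin m)}
    (φ : gadget G ≃g gadget G') : Nonempty (G ≃g G') := by
  have hφ : ∀ u v, Missing G' (φ u) (φ v) ↔ Missing G u v := by
    intro u v
    rw [missing_iff, missing_iff, φ.map_adj_iff, φ.injective.ne_iff]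
  have hex : ∀ (P : Fin m × Fin m × Fin 4 → Prop), (∃ a, P a) ↔ ∃ a, P (φ a) :=
    fun P => φ.surjective.exists
  have htwin : ∀ i, ∃ k, (φ (i, i, 0) = (k, k, 0) ∧ φ (i, i, 1) = (k, k, 1)) ∨
      (φ (i, i, 0) = (k, k, 1) ∧ φ (i, i, 1) = (k, k, 0)) := by
    intro i
    rw [← twin_iff G']
    simp only [hex, hφ, φ.injective.ne_iff]
    rw [twin_iff G]
    exact ⟨i, .inl ⟨rfl, rfl⟩⟩
  choose σ hσ using htwin
  have hcard : n = m := by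
    have := Fintype.card_congr φ.toEquiv
    simp only [Fintype.card_prod, Fintype.card_fin] at this
    exact Nat.mul_self_inj.1 (by lia)
  have hinj : Function.Injective σ := by
    intro i j hij
    have h1 := hσ i
    have h2 := hσ j
    have h3 : ∀ c d, φ (i, i, c) = φ (j, j, d) → i = j := fun c d h => by
      have := φ.injective h
      simp at this
      exact this.1
    rw [hij] at h1
    rcases h1 with h1 | h1 <;> rcases h2 with h2 | h2
    · exact h3 _ _ (h1.1.trans h2.1.symm)
    · exact h3 _ _ (h1.1.trans h2.2.symm)
    · exact h3 _ _ (h1.1.trans h2.2.symm)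
    · exact h3 _ _ (h1.1.trans h2.1.symm)
  have hbij : Function.Bijective σ := by
    rw [Fintype.bijective_iff_injective_and_card]
    exact ⟨hinj, by simpa using hcard⟩
  have hmis : ∀ i j, Missing G' (φ (i, i, 0)) (φ (j, j, 1)) := by
    intro i j
    rw [hφ, missing_x_iff]
    exact .inl ⟨j, rfl⟩
  refine ⟨⟨Equiv.ofBijective σ hbij, ?_⟩⟩
  intro i j
  rw [Equiv.ofBijective_apply, Equiv.ofBijective_apply]
  by_cases hij : i = j
  · subst hij
    simp
  have hadj : G.Adj i j ↔
      ∃ a, Missing G' (φ (i, i, 0)) a ∧ Missing G' (φ (j, j, 1)) a := by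
    rw [adj_iff_exists_missing G hij]
    simp only [hex, hφ]
  have h0 := hmis i j
  -- The isomorphism treats the vertices with roles `x i` and `x j` alike.
  rcases hσ i with h1 | h1 <;> rcases hσ j with h2 | h2
  · rw [hadj, h1.1, h2.2, adj_iff_exists_missing G' (hinj.ne hij)]
  · rw [h1.1, h2.2, missing_x_iff] at h0
    simp at h0
  · rw [h1.1, h2.2, missing_y_iff] at h0
    simp at h0
  · rw [hadj, h1.1, h2.2, SimpleGraph.adj_comm,
      adj_iff_exists_missing G' (hinj.ne (Ne.symm hij))]
    simp only [and_comm]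

end Gadget

/-! ### The adjacency matrix of the gadget -/

/-- An entry of the adjacency matrix, as the machine stores it: whether it lies on the diagonal,
whether it is one, and whether it lies in the row and in the column of a distinguished entry. -/
structure Cell where
  diag : Bool
  adj : Bool
  row : Bool
  col : Bool
  deriving DecidableEq, Fintype

/-- Copy `c` of the pair has a role `x i`. -/
def Cell.isX (p : Cell) (c : Fin 4) : Bool := c = 0 && p.diag

/-- Copy `c` of the pair has a role `y i`. -/
def Cell.isY (p : Cell) (c : Fin 4) : Bool := c = 1 && p.diag

/-- Copy `c` of the pair has a role `z i j` other than that of a filler. -/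
def Cell.isZ (p : Cell) (c : Fin 4) : Bool := (c = 2 && (p.diag || p.adj)) || (c = 3 && p.diag)

/-- The adjacency of copy `c` of the pair `p` and copy `c'` of the pair `q` in the gadget, where `q`
is marked relative to `p`. -/
def adjBit (c : Fin 4) (p : Cell) (c' : Fin 4) (q : Cell) : Bool :=
  !((p.isX c && q.isY c') || (p.isY c && q.isX c') ||
    (q.row && ((p.isX c && q.isZ c') || (p.isZ c && q.isX c'))) ||
    (q.col && ((p.isY c && q.isZ c') || (p.isZ c && q.isY c')))) &&
  !(q.row && q.col && c = c')

open Classical in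
theorem gadget_adj_iff {n : ℕ} (G : SimpleGraph (Fin n)) (i j k l : Fin n) (c c' : Fin 4)
    (b b' : Bool) :
    (gadget G).Adj (i, j, c) (k, l, c') ↔
      adjBit c ⟨i = j, G.Adj i j, b, b'⟩ c' ⟨k = l, G.Adj k l, k = i, l = j⟩ = true := by
  simp only [gadget]
  fin_cases c <;> fin_cases c' <;> simp only [role] <;> split_ifs <;>
    simp_all [Role.Miss, Fin.castSucc_ne_last, adjBit, Cell.isX, Cell.isY, Cell.isZ] <;> grind

/-! ### The machine -/

deriving instance DecidableEq, Fintype for Symbol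

theorem bit_beq_graphEnd (b : Bool) : (Symbol.bit b == .graphEnd) = false := by cases b <;> rfl

theorem bit_beq_rowEnd (b : Bool) : (Symbol.bit b == .rowEnd) = false := by cases b <;> rfl

theorem rowEnd_beq_graphEnd : (Symbol.rowEnd == .graphEnd) = false := rfl

theorem bit_beq_bit_true (b : Bool) : (Symbol.bit b == .bit true) = b := by cases b <;> rfl

/-- The stacks of the machine: the input (which also receives the output in the end), the annotated
matrix and a stack for it to be moved to, a copy of the matrix that drives the main loop, a unary
counter and a stack for it to be moved to, and the output in reverse. -/
inductive Stack
  | input | mat | aux | drive | cnt | cntAux | out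
  deriving DecidableEq

instance : Fintype Stack :=
  ⟨{.input, .mat, .aux, .drive, .cnt, .cntAux, .out}, fun x => by cases x <;> decide⟩

/-- The alphabets of the stackContents. In an annotated matrix, `none` marks the end of a row. -/
abbrev StackSymbol : Stack → Type
  | .input => Symbol
  | .mat => Option Cell
  | .aux => Option Cell
  | .drive => Option Cell
  | .cnt => Unit
  | .cntAux => Unit
  | .out => Symbol

/-- The labels of the machine, one for each loop. -/
inductive Label
  | read | restore | clearCnt | copy | outer | scan (c : Fin 4) | back (c : Fin 4)
  | shiftCol | shiftRow | unshift | clearMat | final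
  deriving Fintype

/-- The registers of the machine: the symbols last taken from a stack, the entry whose row of the
gadget's matrix is being written, and flags. -/
structure State where
  sym : Option Symbol := none
  top : Option (Option Cell) := none
  mark : Bool := false
  pivot : Cell := ⟨false, false, false, false⟩
  seen : Bool := false
  firstRow : Bool := true
  firstCol : Bool := true
  carry : Bool := false
  cur : Bool := false

noncomputable instance : Fintype State :=
  Fintype.ofInjective (fun s => (s.sym, s.top, s.mark, s.pivot, s.seen, s.firstRow, s.firstCol,
    s.carry, s.cur)) fun s t h => by cases s; cases t; simpa using h

/-- The entry in the last symbol taken from a stack with the annotated matrix. -/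
def State.cell (s : State) : Cell := (s.top.getD none).getD ⟨false, false, false, false⟩

/-- The last symbol taken from a stack with the annotated matrix is the end of a row. -/
def State.atRowEnd (s : State) : Bool := s.top == some none

/-- The entry to be stored for the bit that has just been read: it is on the diagonal if the counter
is exhausted for the first time in this row. -/
def State.newCell (s : State) : Cell :=
  ⟨!s.mark && !s.seen, s.sym == some (.bit true), s.firstRow, s.firstCol⟩

open Turing TM2.Stmt in
/-- The program. -/
def program : Label → TM2.Stmt StackSymbol Label State
  | .read =>
    pop .input (fun s x => { s with sym := x }) <|
    branch (fun s => s.sym == none) (load (fun _ => {}) <| goto fun _ => .final) <|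
    branch (fun s => s.sym == some .graphEnd) (load (fun _ => {}) <| goto fun _ => .clearCnt) <|
    branch (fun s => s.sym == some .rowEnd)
      (push .aux (fun _ => none) <| load (fun _ => { firstRow := false }) <|
        goto fun _ => .restore) <|
    pop .cnt (fun s x => { s with mark := x.isSome }) <|
    push .aux (fun s => some s.newCell) <|
    branch (fun s => s.mark || !s.seen)
      (push .cntAux (fun _ => ()) <|
        load (fun s => { seen := s.seen || !s.mark, firstRow := s.firstRow, firstCol := false }) <|
        goto fun _ => .read)
      (load (fun s => { seen := s.seen || !s.mark, firstRow := s.firstRow, firstCol := false }) <|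
        goto fun _ => .read)
  | .restore =>
    pop .cntAux (fun s x => { s with mark := x.isSome }) <|
    branch (fun s => s.mark)
      (push .cnt (fun _ => ()) <| load (fun s => { s with mark := false }) <|
        goto fun _ => .restore) <|
    goto fun _ => .read
  | .clearCnt =>
    pop .cnt (fun s x => { s with mark := x.isSome }) <|
    branch (fun s => s.mark) (load (fun _ => {}) <| goto fun _ => .clearCnt) <|
    goto fun _ => .copy
  | .copy =>
    pop .aux (fun s x => { s with top := x }) <|
    branch (fun s => s.top == none) (goto fun _ => .outer) <|
    push .mat (fun s => s.top.getD none) <| push .drive (fun s => s.top.getD none) <|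
    load (fun _ => {}) <| goto fun _ => .copy
  | .outer =>
    pop .drive (fun s x => { s with top := x }) <|
    branch (fun s => s.top == none) (goto fun _ => .clearMat) <|
    branch (fun s => s.atRowEnd) (load (fun _ => {}) <| goto fun _ => .shiftRow) <|
    load (fun s => { pivot := s.cell }) <| goto fun _ => .scan 0
  | .scan c =>
    pop .mat (fun s x => { s with top := x }) <|
    branch (fun s => s.top == none) (goto fun _ => .back c) <|
    push .aux (fun s => s.top.getD none) <|
    branch (fun s => s.atRowEnd)
      (load (fun s => { pivot := s.pivot }) <| goto fun _ => .scan c) <|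
    push .out (fun s => .bit (adjBit c s.pivot 0 s.cell)) <|
    push .out (fun s => .bit (adjBit c s.pivot 1 s.cell)) <|
    push .out (fun s => .bit (adjBit c s.pivot 2 s.cell)) <|
    push .out (fun s => .bit (adjBit c s.pivot 3 s.cell)) <|
    load (fun s => { pivot := s.pivot }) <| goto fun _ => .scan c
  | .back c =>
    pop .aux (fun s x => { s with top := x }) <|
    branch (fun s => s.top == none)
      (push .out (fun _ => .rowEnd) <|
        if c = 3 then load (fun _ => {}) <| goto fun _ => .shiftCol
        else goto fun _ => .scan (c + 1)) <|
    push .mat (fun s => s.top.getD none) <|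
    load (fun s => { pivot := s.pivot }) <| goto fun _ => .back c
  | .shiftCol =>
    pop .mat (fun s x => { s with top := x }) <|
    branch (fun s => s.top == none) (load (fun _ => {}) <| goto fun _ => .unshift) <|
    branch (fun s => s.atRowEnd)
      (push .aux (fun _ => none) <| load (fun _ => {}) <| goto fun _ => .shiftCol) <|
    push .aux (fun s => some { s.cell with col := s.carry }) <|
    load (fun s => { carry := s.cell.col }) <| goto fun _ => .shiftCol
  | .shiftRow =>
    pop .mat (fun s x => { s with top := x }) <|
    branch (fun s => s.top == none) (load (fun _ => {}) <| goto fun _ => .unshift) <|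
    branch (fun s => s.atRowEnd)
      (push .aux (fun _ => none) <| load (fun s => { carry := s.cur }) <|
        goto fun _ => .shiftRow) <|
    push .aux (fun s => some { s.cell with row := s.carry, col := s.firstCol }) <|
    load (fun s => { carry := s.carry, cur := s.cell.row, firstCol := false }) <|
    goto fun _ => .shiftRow
  | .unshift =>
    pop .aux (fun s x => { s with top := x }) <|
    branch (fun s => s.top == none) (goto fun _ => .outer) <|
    push .mat (fun s => s.top.getD none) <| load (fun _ => {}) <| goto fun _ => .unshift
  | .clearMat =>
    pop .mat (fun s x => { s with top := x }) <|
    branch (fun s => s.top == none)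
      (push .out (fun _ => .graphEnd) <| goto fun _ => .read) <|
    load (fun _ => {}) <| goto fun _ => .clearMat
  | .final =>
    pop .out (fun s x => { s with sym := x }) <|
    branch (fun s => s.sym == none) halt <|
    push .input (fun s => s.sym.getD .graphEnd) <| load (fun _ => {}) <| goto fun _ => .final

/-- The machine that computes the reduction. -/
noncomputable def machine : Turing.FinTM2 where
  K := Stack
  k₀ := .input
  k₁ := .input
  Γ := StackSymbol
  Λ := Label
  main := .read
  σ := State
  initialState := {}
  Γk₀Fin := inferInstanceAs (Fintype Symbol)
  m := program

/-- The contents of the stacks as a function. -/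
def stackContents (i : List Symbol) (m a d : List (Option Cell)) (k k' : List Unit)
    (o : List Symbol) : ∀ k, List (StackSymbol k)
  | .input => i
  | .mat => m
  | .aux => a
  | .drive => d
  | .cnt => k
  | .cntAux => k'
  | .out => o

section Update

variable (i i' : List Symbol) (m a d m' : List (Option Cell)) (k k' l : List Unit) (o : List Symbol)

@[simp] theorem update_input : Function.update (stackContents i m a d k k' o) .input i' =
    stackContents i' m a d k k' o := by
  funext x; cases x <;> rfl

@[simp] theorem update_mat : Function.update (stackContents i m a d k k' o) .mat m' =
    stackContents i m' a d k k' o := by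
  funext x; cases x <;> rfl

@[simp] theorem update_aux : Function.update (stackContents i m a d k k' o) .aux m' =
    stackContents i m m' d k k' o := by
  funext x; cases x <;> rfl

@[simp] theorem update_drive : Function.update (stackContents i m a d k k' o) .drive m' =
    stackContents i m a m' k k' o := by
  funext x; cases x <;> rfl

@[simp] theorem update_cnt : Function.update (stackContents i m a d k k' o) .cnt l =
    stackContents i m a d l k' o := by
  funext x; cases x <;> rfl

@[simp] theorem update_cntAux : Function.update (stackContents i m a d k k' o) .cntAux l =
    stackContents i m a d k l o := by
  funext x; cases x <;> rfl

@[simp] theorem update_out : Function.update (stackContents i m a d k k' o) .out i' =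
    stackContents i m a d k k' i' := by
  funext x; cases x <;> rfl

@[simp] theorem stacks_input : stackContents i m a d k k' o .input = i := rfl
@[simp] theorem stacks_mat : stackContents i m a d k k' o .mat = m := rfl
@[simp] theorem stacks_aux : stackContents i m a d k k' o .aux = a := rfl
@[simp] theorem stacks_drive : stackContents i m a d k k' o .drive = d := rfl
@[simp] theorem stacks_cnt : stackContents i m a d k k' o .cnt = k := rfl
@[simp] theorem stacks_cntAux : stackContents i m a d k k' o .cntAux = k' := rfl
@[simp] theorem stacks_out : stackContents i m a d k k' o .out = o := rfl

end Update

/-- A configuration of the machine. -/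
abbrev Config : Type := Turing.TM2.Cfg StackSymbol Label State

/-- A configuration with a current label. -/
def conf (l : Label) (s : State) (i : List Symbol) (m a d : List (Option Cell)) (k k' : List Unit)
    (o : List Symbol) : Config :=
  ⟨some l, s, stackContents i m a d k k' o⟩

/-- The machine gets from `c` to `c'` in at most `t` steps. -/
def Runs (t : ℕ) (c c' : Config) : Prop :=
  ∃ s ≤ t, (flip bind (Turing.TM2.step program))^[s] (some c) = some c'

theorem Runs.refl (c : Config) : Runs 0 c c := ⟨0, le_rfl, rfl⟩

theorem Runs.mono {t t' : ℕ} {c c' : Config} (h : Runs t c c') (ht : t ≤ t') : Runs t' c c' := by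
  obtain ⟨s, hs, h⟩ := h
  exact ⟨s, hs.trans ht, h⟩

theorem Runs.trans {t t' : ℕ} {c c' c'' : Config} (h : Runs t c c') (h' : Runs t' c' c'') :
    Runs (t + t') c c'' := by
  obtain ⟨s, hs, h⟩ := h
  obtain ⟨s', hs', h'⟩ := h'
  exact ⟨s' + s, by lia, by rw [Function.iterate_add_apply, h, h']⟩

theorem Runs.step {t : ℕ} {c c' c'' : Config} (h : Turing.TM2.step program c = some c')
    (h' : Runs t c' c'') : Runs (t + 1) c c'' := by
  obtain ⟨s, hs, h'⟩ := h'
  exact ⟨s + 1, by lia, by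
    rw [Function.iterate_succ_apply, ← h']; exact congrArg _ h⟩

theorem Runs.one {c c' : Config} (h : Turing.TM2.step program c = some c') : Runs 1 c c' :=
  .step h (.refl _)

section Loops

variable (i : List Symbol) (m a d : List (Option Cell)) (k k' : List Unit) (o : List Symbol)

theorem runs_restore (s : State) (hs : s.mark = false) (x y : ℕ) :
    Runs (x + 1) (conf .restore s i m a d (.replicate y ()) (.replicate x ()) o)
      (conf .read s i m a d (.replicate (y + x) ()) [] o) := by
  obtain ⟨_, _, _, _, _, _, _, _, _⟩ := s
  subst hs
  induction x generalizing y with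
  | zero => exact .one (by simp [conf, program])
  | succ x ih =>
    rw [show y + (x + 1) = y + 1 + x by lia]
    refine .step ?_ (ih (y + 1))
    simp [conf, program, List.replicate_succ]

theorem runs_clearCnt :
    Runs (k.length + 1) (conf .clearCnt {} i m a d k k' o) (conf .copy {} i m a d [] k' o) := by
  induction k with
  | nil => exact .one (by simp [conf, program])
  | cons _ l ih => exact .step (by simp [conf, program]) ih

theorem runs_copy :
    Runs (a.length + 1) (conf .copy {} i m a d k k' o)
      (conf .outer {} i (a.reverse ++ m) [] (a.reverse ++ d) k k' o) := by
  induction a generalizing m d with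
  | nil => exact .one (by simp [conf, program])
  | cons x l ih =>
    simp only [List.reverse_cons, List.append_assoc, List.singleton_append]
    exact .step (by simp [conf, program]) (ih ..)

theorem runs_unshift :
    Runs (a.length + 1) (conf .unshift {} i m a d k k' o)
      (conf .outer {} i (a.reverse ++ m) [] d k k' o) := by
  induction a generalizing m with
  | nil => exact .one (by simp [conf, program])
  | cons x l ih =>
    simp only [List.reverse_cons, List.append_assoc, List.singleton_append]
    exact .step (by simp [conf, program]) (ih ..)

theorem runs_clearMat :
    Runs (m.length + 1) (conf .clearMat {} i m a d k k' o)
      (conf .read {} i [] a d k k' (.graphEnd :: o)) := by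
  induction m with
  | nil => exact .one (by simp [conf, program])
  | cons x l ih => exact .step (by simp [conf, program]) ih

theorem runs_final :
    Runs (o.length + 1) (conf .final {} i m a d k k' o)
      ⟨none, {}, stackContents (o.reverse ++ i) m a d k k' []⟩ := by
  induction o generalizing i with
  | nil => exact .one (by simp [conf, program])
  | cons x l ih =>
    simp only [List.reverse_cons, List.append_assoc, List.singleton_append]
    exact .step (by simp [conf, program]) (ih ..)

/-- The part of row `c` of the pair `p` that is written for an entry of the annotated matrix. -/
def emit (c : Fin 4) (p : Cell) : Option Cell → List Symbol
  | none => []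
  | some q => (List.finRange 4).map fun c' => .bit (adjBit c p c' q)

theorem runs_scan (c : Fin 4) (p : Cell) :
    Runs (m.length + 1) (conf (.scan c) { pivot := p } i m a d k k' o)
      (conf (.back c) { pivot := p } i [] (m.reverse ++ a) d k k'
        ((m.flatMap (emit c p)).reverse ++ o)) := by
  induction m generalizing a o with
  | nil => exact .one (by simp [conf, program])
  | cons x l ih =>
    simp only [List.reverse_cons, List.append_assoc, List.singleton_append, List.flatMap_cons,
      List.reverse_append]
    cases x with
    | none => exact .step (by simp [conf, program, State.atRowEnd, emit]) (ih ..)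
    | some q =>
      exact .step
        (by simp [conf, program, State.atRowEnd, emit, State.cell, List.finRange_succ]) (ih ..)

theorem runs_back (c : Fin 4) (p : Cell) :
    Runs (a.length + 1) (conf (.back c) { pivot := p } i m a d k k' o)
      (conf (if c = 3 then .shiftCol else .scan (c + 1)) (if c = 3 then {} else { pivot := p })
        i (a.reverse ++ m) [] d k k' (.rowEnd :: o)) := by
  induction a generalizing m with
  | nil => exact .one (by by_cases h : c = 3 <;> simp [conf, program, h])
  | cons x l ih =>
    simp only [List.reverse_cons, List.append_assoc, List.singleton_append]
    exact .step (by simp [conf, program]) (ih ..)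

/-- Moves the column marks to the next column. -/
def shiftCol : Bool → List (Option Cell) → List (Option Cell)
  | _, [] => []
  | _, none :: l => none :: shiftCol false l
  | b, some q :: l => some { q with col := b } :: shiftCol q.col l

theorem runs_shiftCol (b : Bool) :
    Runs (m.length + 1) (conf .shiftCol { carry := b } i m a d k k' o)
      (conf .unshift {} i [] ((shiftCol b m).reverse ++ a) d k k' o) := by
  induction m generalizing a b with
  | nil => exact .one (by simp [conf, program, shiftCol])
  | cons x l ih =>
    cases x with
    | none =>
      simp only [List.reverse_cons, List.append_assoc, List.singleton_append, shiftCol]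
      exact .step (by simp [conf, program, State.atRowEnd]) (ih ..)
    | some q =>
      simp only [List.reverse_cons, List.append_assoc, List.singleton_append, shiftCol]
      exact .step (by simp [conf, program, State.atRowEnd, State.cell]) (ih ..)

/-- Moves the row marks to the next row, and the column marks to the first column. The arguments are
the mark of the previous row, that of the present row, and whether the present column is the first
one. -/
def shiftRow : Bool → Bool → Bool → List (Option Cell) → List (Option Cell)
  | _, _, _, [] => []
  | _, r, _, none :: l => none :: shiftRow r false true l
  | b, _, f, some q :: l => some { q with row := b, col := f } :: shiftRow b q.row false l

theorem runs_shiftRow (b r f : Bool) :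
    Runs (m.length + 1) (conf .shiftRow { carry := b, cur := r, firstCol := f } i m a d k k' o)
      (conf .unshift {} i [] ((shiftRow b r f m).reverse ++ a) d k k' o) := by
  induction m generalizing a b r f with
  | nil => exact .one (by simp [conf, program, shiftRow])
  | cons x l ih =>
    cases x with
    | none =>
      simp only [List.reverse_cons, List.append_assoc, List.singleton_append, shiftRow]
      exact .step (by simp [conf, program, State.atRowEnd]) (ih ..)
    | some q =>
      simp only [List.reverse_cons, List.append_assoc, List.singleton_append, shiftRow]
      exact .step (by simp [conf, program, State.atRowEnd, State.cell]) (ih ..)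

end Loops

/-! ### What the machine computes -/

/-- The entry `(i, j)` of the matrix `A`, marked relative to the entry `(p, q)`. -/
def cell (A : ℕ → ℕ → Bool) (p q i j : ℕ) : Cell := ⟨i == j, A i j, i == p, j == q⟩

/-- Row `i` of the matrix `A`, marked relative to the entry `(p, q)`. -/
def rowWord (A : ℕ → ℕ → Bool) (n p q i : ℕ) : List (Option Cell) :=
  (List.range n).map (fun j => some (cell A p q i j)) ++ [none]

/-- The matrix `A`, marked relative to the entry `(p, q)`. -/
def word (A : ℕ → ℕ → Bool) (n p q : ℕ) : List (Option Cell) :=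
  (List.range n).flatMap (rowWord A n p q)

/-- The way in which a graph with adjacency matrix `A` is written down. -/
def inputWord (A : ℕ → ℕ → Bool) (n : ℕ) : List Symbol :=
  (List.range n).flatMap (fun i => (List.range n).map (fun j => .bit (A i j)) ++ [.rowEnd]) ++
    [.graphEnd]

/-- The rows of the gadget's adjacency matrix that belong to the pair `(i, j)`. -/
def gadgetRows (A : ℕ → ℕ → Bool) (n i j : ℕ) : List Symbol :=
  (List.finRange 4).flatMap fun c =>
    (word A n i j).flatMap (emit c (cell A 0 0 i j)) ++ [.rowEnd]

/-- The way in which the gadget of a graph with adjacency matrix `A` is written down. -/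
def outputWord (A : ℕ → ℕ → Bool) (n : ℕ) : List Symbol :=
  (List.range n).flatMap (fun i => (List.range n).flatMap (gadgetRows A n i)) ++ [.graphEnd]

theorem length_word (A : ℕ → ℕ → Bool) (n p q : ℕ) : (word A n p q).length = n * (n + 1) := by
  simp [word, rowWord, List.length_flatMap]

theorem length_inputWord (A : ℕ → ℕ → Bool) (n : ℕ) :
    (inputWord A n).length = n * (n + 1) + 1 := by
  simp [inputWord, List.length_flatMap]

theorem length_outputWord (A : ℕ → ℕ → Bool) (n : ℕ) :
    (outputWord A n).length = 4 * n ^ 2 * (4 * n ^ 2 + 1) + 1 := by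
  have h : ∀ i j c, ((word A n i j).flatMap (emit c (cell A 0 0 i j))).length = 4 * n ^ 2 := by
    intro i j c
    simp [word, rowWord, List.length_flatMap, List.flatMap_assoc, List.flatMap_append,
      List.flatMap_map, emit]
    ring
  simp [outputWord, gadgetRows, List.length_flatMap, h]
  ring

section Shift

variable (A : ℕ → ℕ → Bool) (n p q i : ℕ)

theorem shiftCol_cells (m j : ℕ) (l : List (Option Cell)) :
    shiftCol (j == q + 1)
      ((List.range' j m).map (fun j => some (cell A p q i j)) ++ none :: l) =
    (List.range' j m).map (fun j => some (cell A p (q + 1) i j)) ++ none :: shiftCol false l := by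
  induction m generalizing j with
  | zero => simp [shiftCol]
  | succ m ih =>
    have h : (cell A p q i j).col = (j + 1 == q + 1) := by simp [cell]
    simp only [List.range'_succ, List.map_cons, List.cons_append, shiftCol, h, ih]
    rfl

theorem shiftCol_word : shiftCol false (word A n p q) = word A n p (q + 1) := by
  unfold word
  induction List.range n with
  | nil => rfl
  | cons i l ih =>
    rw [List.flatMap_cons, List.flatMap_cons, ← ih]
    have := shiftCol_cells A p q i n 0 (l.flatMap (rowWord A n p q))
    rw [← List.range_eq_range'] at this
    simpa [rowWord] using this

theorem shiftRow_cells (m j : ℕ) (r : Bool) (hr : m = 0 → r = (i == p)) (l : List (Option Cell)) :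
    shiftRow (i == p + 1) r (j == 0)
      ((List.range' j m).map (fun j => some (cell A p q i j)) ++ none :: l) =
    (List.range' j m).map (fun j => some (cell A (p + 1) 0 i j)) ++
      none :: shiftRow (i == p) false true l := by
  induction m generalizing j r with
  | zero => simp [shiftRow, hr rfl]
  | succ m ih =>
    have h : (cell A p q i j).row = (i == p) := rfl
    have h' : false = (j + 1 == 0) := by simp
    simp only [List.range'_succ, List.map_cons, List.cons_append, shiftRow, h]
    rw [h', ih _ _ fun _ => rfl]
    rfl

theorem shiftRow_word : shiftRow false false true (word A n p q) = word A n (p + 1) 0 := by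
  rcases Nat.eq_zero_or_pos n with rfl | hn
  · rfl
  have h : ∀ m i, shiftRow (i == p + 1) false true ((List.range' i m).flatMap (rowWord A n p q)) =
      (List.range' i m).flatMap (rowWord A n (p + 1) 0) := by
    intro m
    induction m with
    | zero => intro i; rfl
    | succ m ih =>
      intro i
      rw [List.range'_succ, List.flatMap_cons, List.flatMap_cons, ← ih]
      have := shiftRow_cells A p q i n 0 false (fun h => absurd h hn.ne')
        ((List.range' (i + 1) m).flatMap (rowWord A n p q))
      rw [← List.range_eq_range'] at this
      have h' : (i + 1 == p + 1) = (i == p) := by simp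
      rw [h']
      simpa [rowWord] using this
  have := h n 0
  rw [← List.range_eq_range'] at this
  exact this

end Shift

section Run

variable (A : ℕ → ℕ → Bool) (n : ℕ)

/-- While row `i` is read, the counter holds `i` minus the number of entries read, and the other
counter stack the number of entries read, up to `i + 1`. -/
theorem runs_readCells (i : ℕ) (fr : Bool) (rest : List Symbol) (M a d : List (Option Cell))
    (o : List Symbol) (m j : ℕ) :
    Runs m
      (conf .read { seen := decide (i < j), firstRow := fr, firstCol := j == 0 }
        ((List.range' j m).map (fun j => .bit (A i j)) ++ rest) M a d
        (.replicate (i - j) ()) (.replicate (min j (i + 1)) ()) o)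
      (conf .read { seen := decide (i < j + m), firstRow := fr, firstCol := j + m == 0 }
        rest M (((List.range' j m).map fun j => some ⟨i == j, A i j, fr, j == 0⟩).reverse ++ a) d
        (.replicate (i - (j + m)) ()) (.replicate (min (j + m) (i + 1)) ()) o) := by
  induction m generalizing j a with
  | zero => exact .refl _
  | succ m ih =>
    have h := ih (some ⟨i == j, A i j, fr, j == 0⟩ :: a) (j + 1)
    rw [show j + 1 + m = j + (m + 1) by lia] at h
    simp only [List.range'_succ, List.map_cons, List.cons_append, List.reverse_cons,
      List.append_assoc, List.nil_append]
    refine .step ?_ h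
    rcases lt_trichotomy j i with hj | rfl | hj
    · have h1 : i - j = (i - (j + 1)) + 1 := by lia
      have h2 : min (j + 1) (i + 1) = min j (i + 1) + 1 := by lia
      have h3 : (i == j) = false := by simp; lia
      have h4 : ¬ i < j := by lia
      have h5 : ¬ i < j + 1 := by lia
      rw [h1, h2, h3]
      simp [conf, program, List.replicate_succ, State.newCell, bit_beq_graphEnd,
        bit_beq_rowEnd, bit_beq_bit_true, h4, h5]
    · simp [conf, program, List.replicate_succ, State.newCell, bit_beq_graphEnd,
        bit_beq_rowEnd, bit_beq_bit_true]
    · have h1 : i - j = 0 := by lia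
      have h1' : i - (j + 1) = 0 := by lia
      have h2 : min (j + 1) (i + 1) = i + 1 := by lia
      have h2' : min j (i + 1) = i + 1 := by lia
      have h3 : (i == j) = false := by simp; lia
      have h5 : i < j + 1 := by lia
      rw [h1, h1', h2, h2', h3]
      simp [conf, program, State.newCell, bit_beq_graphEnd, bit_beq_rowEnd, bit_beq_bit_true, hj,
        h5]

/-- Reading the rows leaves the annotated matrix, in reverse, on the auxiliary stack. The
distinguished entry is `(0, 0)`. -/
theorem runs_readRows (rest : List Symbol) (M a d : List (Option Cell)) (o : List Symbol) (m i : ℕ)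
    (hm : i + m ≤ n) :
    Runs (m * (2 * n + 2))
      (conf .read { firstRow := i == 0 }
        ((List.range' i m).flatMap
          (fun i => (List.range n).map (fun j => .bit (A i j)) ++ [.rowEnd]) ++ rest)
        M a d (.replicate i ()) [] o)
      (conf .read { firstRow := i + m == 0 } rest M
        (((List.range' i m).flatMap (rowWord A n 0 0)).reverse ++ a) d
        (.replicate (i + m) ()) [] o) := by
  induction m generalizing i a with
  | zero => exact (Runs.refl _).mono (by lia)
  | succ m ih =>
    have h1 := runs_readCells A i (i == 0) (.rowEnd :: ((List.range' (i + 1) m).flatMap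
      (fun i => (List.range n).map (fun j => .bit (A i j)) ++ [.rowEnd]) ++ rest)) M a d o n 0
    have h3 := ih (((rowWord A n 0 0 i)).reverse ++ a) (i + 1) (by lia)
    have hi : i < n := by lia
    have hn : (n == 0) = false := by simp; lia
    have hi' : (i + 1 == 0) = false := by simp
    have hmin : min n (i + 1) = i + 1 := by lia
    simp only [Nat.zero_add, Nat.sub_eq_zero_of_le hi.le, hi, hn, hmin, decide_true,
      ← List.range_eq_range', Nat.not_lt_zero, decide_false, Nat.zero_min, Nat.sub_zero,
      List.replicate_zero] at h1
    have h2 := runs_restore ((List.range' (i + 1) m).flatMap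
      (fun i => (List.range n).map (fun j => .bit (A i j)) ++ [.rowEnd]) ++ rest) M
      ((rowWord A n 0 0 i).reverse ++ a) d o { firstRow := false } rfl (i + 1) 0
    rw [hi', show i + 1 + m = i + (m + 1) by lia] at h3
    rw [Nat.zero_add, List.replicate_zero] at h2
    have h := h1.trans (Runs.step ?_ (h2.trans h3))
    · simp only [List.range'_succ, List.flatMap_cons, List.append_assoc, List.reverse_append,
        List.cons_append, List.nil_append] at h ⊢
      exact h.mono (by rw [Nat.succ_mul]; lia)
    · simp [conf, program, rowWord, cell, rowEnd_beq_graphEnd]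

variable (i : List Symbol) (d : List (Option Cell)) (k k' : List Unit) (o : List Symbol)

/-- One row of the gadget's matrix. -/
theorem runs_row (m : List (Option Cell)) (c : Fin 4) (p : Cell) :
    Runs (2 * m.length + 2)
      (conf (.scan c) { pivot := p } i m [] d k k' o)
      (conf (if c = 3 then .shiftCol else .scan (c + 1)) (if c = 3 then {} else { pivot := p })
        i m [] d k k' ((m.flatMap (emit c p) ++ [Symbol.rowEnd]).reverse ++ o)) := by
  have h1 := runs_scan i m [] d k k' o c p
  have h2 := runs_back i [] (m.reverse ++ []) d k k' ((m.flatMap (emit c p)).reverse ++ o) c p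
  rw [List.append_nil] at h1 h2
  rw [List.reverse_reverse, List.append_nil] at h2
  rw [List.reverse_append, List.reverse_singleton]
  exact (h1.trans h2).mono (by rw [List.length_reverse]; lia)

/-- The main loop writes the rows that belong to the entry `(p, q)` and moves the marks to the next
column. -/
theorem runs_entry (p q : ℕ) :
    Runs (10 * (n * (n + 1)) + 11)
      (conf .outer {} i (word A n p q) [] (some (cell A 0 0 p q) :: d) k k' o)
      (conf .outer {} i (word A n p (q + 1)) [] d k k' ((gadgetRows A n p q).reverse ++ o)) := by
  have h0 : Turing.TM2.step program
      (conf .outer {} i (word A n p q) [] (some (cell A 0 0 p q) :: d) k k' o) =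
      some (conf (.scan 0) { pivot := cell A 0 0 p q } i (word A n p q) [] d k k' o) := by
    simp [conf, program, State.atRowEnd, State.cell]
  have hrow := fun c o => runs_row i d k k' o (word A n p q) c (cell A 0 0 p q)
  let X : Fin 4 → List Symbol := fun c =>
    (word A n p q).flatMap (emit c (cell A 0 0 p q)) ++ [Symbol.rowEnd]
  have h1 := hrow 0 o
  have h2 := hrow 1 ((X 0).reverse ++ o)
  have h3 := hrow 2 ((X 1).reverse ++ ((X 0).reverse ++ o))
  have h4 := hrow 3 ((X 2).reverse ++ ((X 1).reverse ++ ((X 0).reverse ++ o)))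
  have ho : (gadgetRows A n p q).reverse ++ o =
      (X 3).reverse ++ ((X 2).reverse ++ ((X 1).reverse ++ ((X 0).reverse ++ o))) := by
    have : gadgetRows A n p q = X 0 ++ (X 1 ++ (X 2 ++ X 3)) := by
      simp [gadgetRows, List.finRange_succ, X]
    simp only [this, List.reverse_append, List.append_assoc]
  rw [ho]
  have h5 := runs_shiftCol i (word A n p q) [] d k k'
    ((X 3).reverse ++ ((X 2).reverse ++ ((X 1).reverse ++ ((X 0).reverse ++ o)))) false
  have h6 := runs_unshift i [] ((word A n p (q + 1)).reverse ++ []) d k k'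
    ((X 3).reverse ++ ((X 2).reverse ++ ((X 1).reverse ++ ((X 0).reverse ++ o))))
  rw [shiftCol_word] at h5
  simp only [List.append_nil, List.reverse_reverse, List.length_reverse, length_word]
    at h1 h2 h3 h4 h5 h6
  exact (Runs.step h0 (h1.trans (h2.trans (h3.trans (h4.trans (h5.trans h6)))))).mono (by lia)

/-- At the end of a row, the main loop moves the marks to the start of the next row. -/
theorem runs_rowEnd (p q : ℕ) :
    Runs (10 * (n * (n + 1)) + 11)
      (conf .outer {} i (word A n p q) [] (none :: d) k k' o)
      (conf .outer {} i (word A n (p + 1) 0) [] d k k' o) := by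
  have h0 : Turing.TM2.step program
      (conf .outer {} i (word A n p q) [] (none :: d) k k' o) =
      some (conf .shiftRow {} i (word A n p q) [] d k k' o) := by
    simp [conf, program, State.atRowEnd]
  have h5 := runs_shiftRow i (word A n p q) [] d k k' o false false true
  have h6 := runs_unshift i [] ((word A n (p + 1) 0).reverse ++ []) d k k' o
  rw [shiftRow_word] at h5
  simp only [List.append_nil, List.reverse_reverse, List.length_reverse, length_word] at h5 h6
  exact (Runs.step h0 (h5.trans h6)).mono (by lia)

theorem runs_entries (p : ℕ) (m q : ℕ) :
    Runs (m * (10 * (n * (n + 1)) + 11))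
      (conf .outer {} i (word A n p q) []
        ((List.range' q m).map (fun j => some (cell A 0 0 p j)) ++ d) k k' o)
      (conf .outer {} i (word A n p (q + m)) [] d k k'
        (((List.range' q m).flatMap (gadgetRows A n p)).reverse ++ o)) := by
  induction m generalizing q o with
  | zero => exact (Runs.refl _).mono (by lia)
  | succ m ih =>
    have h := ih ((gadgetRows A n p q).reverse ++ o) (q + 1)
    rw [show q + 1 + m = q + (m + 1) by lia] at h
    simp only [List.range'_succ, List.map_cons, List.cons_append, List.flatMap_cons,
      List.reverse_append, List.append_assoc]
    exact ((runs_entry A n i _ k k' o p q).trans h).mono (by rw [Nat.succ_mul]; lia)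

theorem runs_outer (m p : ℕ) :
    Runs (m * (n + 1) * (10 * (n * (n + 1)) + 11))
      (conf .outer {} i (word A n p 0) []
        ((List.range' p m).flatMap (rowWord A n 0 0) ++ d) k k' o)
      (conf .outer {} i (word A n (p + m) 0) [] d k k'
        (((List.range' p m).flatMap
          fun i => (List.range n).flatMap (gadgetRows A n i)).reverse ++ o)) := by
  induction m generalizing p o with
  | zero => exact (Runs.refl _).mono (by lia)
  | succ m ih =>
    have h1 := runs_entries A n i (none :: ((List.range' (p + 1) m).flatMap (rowWord A n 0 0) ++ d))
      k k' o p n 0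
    rw [← List.range_eq_range'] at h1
    have h2 := runs_rowEnd A n i ((List.range' (p + 1) m).flatMap (rowWord A n 0 0) ++ d) k k'
      (((List.range n).flatMap (gadgetRows A n p)).reverse ++ o) p (0 + n)
    have h3 := ih (((List.range n).flatMap (gadgetRows A n p)).reverse ++ o) (p + 1)
    rw [show p + 1 + m = p + (m + 1) by lia] at h3
    have h := (h1.trans h2).trans h3
    simp only [List.range'_succ, List.flatMap_cons, List.reverse_append, List.append_assoc, rowWord,
      List.cons_append, List.nil_append] at h ⊢
    exact h.mono (by ring_nf; lia)

/-- The machine replaces a graph by its gadget. -/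
theorem runs_graph :
    Runs (100 * (inputWord A n).length ^ 2)
      (conf .read {} (inputWord A n ++ i) [] [] [] [] [] o)
      (conf .read {} i [] [] [] [] [] ((outputWord A n).reverse ++ o)) := by
  have h1 := runs_readRows A n (.graphEnd :: i) [] [] [] o n 0 (by lia)
  have h2 : Turing.TM2.step program
      (conf .read { firstRow := 0 + n == 0 } (.graphEnd :: i) [] ((word A n 0 0).reverse ++ []) []
        (.replicate (0 + n) ()) [] o) =
      some (conf .clearCnt {} i [] ((word A n 0 0).reverse ++ []) []
        (.replicate (0 + n) ()) [] o) := by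
    simp [conf, program]
  have h3 := runs_clearCnt i [] ((word A n 0 0).reverse ++ []) [] (.replicate (0 + n) ()) [] o
  have h4 := runs_copy i [] ((word A n 0 0).reverse ++ []) [] [] [] o
  have h5 := runs_outer A n i [] [] [] o n 0
  have h6 : Turing.TM2.step program
      (conf .outer {} i (word A n (0 + n) 0) [] [] [] []
        (((List.range n).flatMap
          fun i => (List.range n).flatMap (gadgetRows A n i)).reverse ++ o)) =
      some (conf .clearMat {} i (word A n (0 + n) 0) [] [] [] []
        (((List.range n).flatMap
          fun i => (List.range n).flatMap (gadgetRows A n i)).reverse ++ o)) := by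
    simp [conf, program]
  have h7 := runs_clearMat i (word A n (0 + n) 0) [] [] [] []
    (((List.range n).flatMap fun i => (List.range n).flatMap (gadgetRows A n i)).reverse ++ o)
  rw [← List.range_eq_range'] at h1 h5
  simp only [List.append_nil, List.reverse_reverse, List.length_reverse, length_word,
    List.length_replicate] at h1 h2 h3 h4 h5 h6 h7
  have h := h1.trans (.step h2 (h3.trans (h4.trans (h5.trans (.step h6 h7)))))
  simp only [inputWord, outputWord, List.reverse_append, List.append_assoc, List.reverse_singleton,
    List.cons_append, List.nil_append] at h ⊢
  refine h.mono ?_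
  have hl := length_inputWord A n
  simp only [inputWord] at hl
  rw [hl]
  nlinarith [Nat.zero_le n, Nat.zero_le (n * n), Nat.zero_le (n * n * n)]

end Run

/-! ### The reduction -/

theorem finRange_mul (m k : ℕ) : List.finRange (m * k) =
    (List.finRange m).flatMap fun i => (List.finRange k).map fun j => finProdFinEquiv (i, j) := by
  rw [← List.map_id (List.finRange (m * k)), ← List.ofFn_eq_map, List.ofFn_mul, List.flatMap_def,
    List.ofFn_eq_map]
  congr 1
  refine List.map_congr_left fun i _ => ?_
  rw [List.ofFn_eq_map]
  refine List.map_congr_left fun j _ => Fin.ext ?_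
  simp only [finProdFinEquiv_apply_val, id_eq]
  ring

/-- The triples, in the order in which the machine lists the vertices of the gadget. -/
def tripleEquiv (n : ℕ) : Fin n × Fin n × Fin 4 ≃ Fin (n * (n * 4)) :=
  (Equiv.prodCongr (Equiv.refl _) finProdFinEquiv).trans finProdFinEquiv

theorem finRange_triples (n : ℕ) : List.finRange (n * (n * 4)) =
    (List.finRange n).flatMap fun i => (List.finRange n).flatMap fun j =>
      (List.finRange 4).map fun c => tripleEquiv n (i, j, c) := by
  rw [finRange_mul, finRange_mul]
  simp only [List.map_flatMap, List.map_map]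
  rfl

theorem flatMap_finRange_triples {α : Type*} (n : ℕ) (f : Fin (n * (n * 4)) → List α) :
    (List.finRange (n * (n * 4))).flatMap f =
    (List.finRange n).flatMap fun i => (List.finRange n).flatMap fun j =>
      (List.finRange 4).flatMap fun c => f (tripleEquiv n (i, j, c)) := by
  simp only [finRange_triples, List.flatMap_assoc, List.flatMap_map]

/-- The gadget of a graph, with the vertices numbered. -/
noncomputable def gadgetGraph (G : FinGraph) : FinGraph where
  order := G.order * (G.order * 4)
  graph := (gadget G.graph).comap (tripleEquiv G.order).symm

/-- The gadget and the numbered gadget are isomorphic. -/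
noncomputable def gadgetGraphIso (G : FinGraph) : (gadgetGraph G).graph ≃g gadget G.graph where
  toEquiv := (tripleEquiv G.order).symm
  map_rel_iff' := Iff.rfl

open Classical in
/-- The adjacency matrix of a graph, extended by zeros. -/
noncomputable def adjMatrixBool (G : FinGraph) (i j : ℕ) : Bool :=
  decide (∃ (hi : i < G.order) (hj : j < G.order), G.graph.Adj ⟨i, hi⟩ ⟨j, hj⟩)

open Classical in
theorem adjMatrixBool_val (G : FinGraph) (i j : Fin G.order) :
    adjMatrixBool G i j = decide (G.graph.Adj i j) := by
  simp [adjMatrixBool]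

theorem flatMap_range_eq {α : Type*} (n : ℕ) (f : ℕ → List α) :
    (List.range n).flatMap f = (List.finRange n).flatMap fun i : Fin n => f i.val := by
  rw [← List.map_coe_finRange_eq_range, List.flatMap_map]

theorem map_range_eq {α : Type*} (n : ℕ) (f : ℕ → α) :
    (List.range n).map f = (List.finRange n).map fun i : Fin n => f i.val := by
  rw [← List.map_coe_finRange_eq_range, List.map_map]
  rfl

theorem inputWord_eq_encodeGraph (G : FinGraph) :
    inputWord (adjMatrixBool G) G.order = encodeGraph G := by
  simp only [inputWord, encodeGraph, flatMap_range_eq, map_range_eq, adjMatrixBool_val]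

theorem outputWord_eq_encodeGraph (G : FinGraph) :
    outputWord (adjMatrixBool G) G.order = encodeGraph (gadgetGraph G) := by
  classical
  have hrow : ∀ (i j : Fin G.order) (c : Fin 4),
      (word (adjMatrixBool G) G.order i j).flatMap (emit c (cell (adjMatrixBool G) 0 0 i j)) =
      (List.finRange (gadgetGraph G).order).map fun t => Symbol.bit
        (decide ((gadgetGraph G).graph.Adj (tripleEquiv G.order (i, j, c)) t)) := by
    intro i j c
    simp only [word, gadgetGraph, rowWord, finRange_triples, flatMap_range_eq, map_range_eq,
      List.flatMap_assoc, List.flatMap_append, List.flatMap_map, List.map_flatMap, List.map_map,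
      List.flatMap_singleton, emit, List.append_nil]
    refine List.flatMap_congr fun k _ => List.flatMap_congr fun l _ =>
      List.map_congr_left fun c' _ => ?_
    simp only [Function.comp_apply, SimpleGraph.comap_adj, Equiv.symm_apply_apply]
    rw [Symbol.bit.injEq, Bool.eq_iff_iff, decide_eq_true_iff,
      gadget_adj_iff _ _ _ _ _ _ _ (i.val == 0) (j.val == 0)]
    simp only [cell, adjMatrixBool_val, beq_eq_decide, Fin.val_inj]
  rw [outputWord, encodeGraph]
  simp only [flatMap_range_eq, gadgetRows, hrow]
  congr 1
  exact (flatMap_finRange_triples G.order fun t =>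
    (List.finRange (gadgetGraph G).order).map
      (fun t' => Symbol.bit (decide ((gadgetGraph G).graph.Adj t t'))) ++ [Symbol.rowEnd]).symm

/-- The map of the reduction. -/
noncomputable def reduction (p : FinGraph × FinGraph) : FinGraph × FinGraph :=
  (gadgetGraph p.1, gadgetGraph p.2)

theorem initList_machine (l : List Symbol) :
    Turing.initList machine l = conf .read {} l [] [] [] [] [] [] := by
  unfold Turing.initList conf
  congr 1
  funext k
  cases k <;> rfl

theorem haltList_machine (l : List Symbol) :
    Turing.haltList machine l = ⟨none, {}, stackContents l [] [] [] [] [] []⟩ := by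
  unfold Turing.haltList
  congr 1
  funext k
  cases k <;> rfl

theorem runs_reduction (p : FinGraph × FinGraph) :
    Runs (200 * (encodePair p).length ^ 2 + 200)
      (Turing.initList machine (encodePair p))
      (Turing.haltList machine (encodePair (reduction p))) := by
  rw [initList_machine, haltList_machine]
  have h1 := runs_graph (adjMatrixBool p.1) p.1.order (encodeGraph p.2) []
  have h2 := runs_graph (adjMatrixBool p.2) p.2.order [] (encodeGraph (gadgetGraph p.1)).reverse
  have h3 := runs_final [] [] [] [] [] []
    ((encodeGraph (gadgetGraph p.2)).reverse ++ (encodeGraph (gadgetGraph p.1)).reverse)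
  have h4 : Turing.TM2.step program (conf .read {} [] [] [] [] [] []
      ((encodeGraph (gadgetGraph p.2)).reverse ++ (encodeGraph (gadgetGraph p.1)).reverse)) =
      some (conf .final {} [] [] [] [] [] []
      ((encodeGraph (gadgetGraph p.2)).reverse ++ (encodeGraph (gadgetGraph p.1)).reverse)) := by
    simp [conf, program]
  have hl : ∀ G : FinGraph, (encodeGraph (gadgetGraph G)).length ≤
      16 * (encodeGraph G).length ^ 2 := by
    intro G
    rw [← outputWord_eq_encodeGraph, ← inputWord_eq_encodeGraph, length_outputWord,
      length_inputWord]
    nlinarith [Nat.zero_le G.order, Nat.zero_le (G.order ^ 3)]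
  rw [outputWord_eq_encodeGraph, inputWord_eq_encodeGraph, List.append_nil] at h1
  rw [outputWord_eq_encodeGraph, inputWord_eq_encodeGraph, List.append_nil] at h2
  have h := h1.trans (h2.trans (.step h4 h3))
  rw [← List.reverse_append, List.reverse_reverse, List.append_nil] at h
  refine Runs.mono h ?_
  have e1 := hl p.1
  have e2 := hl p.2
  simp only [encodePair, List.length_append, List.length_reverse]
  nlinarith [Nat.zero_le ((encodeGraph p.1).length * (encodeGraph p.2).length)]

/-- The reduction can be computed in polynomial time. -/
noncomputable def computableInPolyTimeReduction :
    Turing.TM2ComputableInPolyTime encodePair encodePair reduction where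
  tm := machine
  inputAlphabet := Equiv.refl Symbol
  outputAlphabet := Equiv.refl Symbol
  time := 200 * Polynomial.X ^ 2 + 200
  outputsFun p :=
    { steps := (runs_reduction p).choose
      evals_in_steps := by
        have h := (runs_reduction p).choose_spec.2
        have key : ∀ l l' : List Symbol, l = encodePair p → l' = encodePair (reduction p) →
            (flip bind machine.step)^[(runs_reduction p).choose]
              (some (Turing.initList machine l)) = some (Turing.haltList machine l') := by
          rintro _ _ rfl rfl
          exact h
        exact key _ _ (List.map_id _) (List.map_id _)
      steps_le_m := by
        simpa using (runs_reduction p).choose_spec.1 }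

theorem nonempty_gadget_iso {n m : ℕ} {G : SimpleGraph (Fin n)} {G' : SimpleGraph (Fin m)}
    (φ : G ≃g G') : Nonempty (gadget G ≃g gadget G') := by
  classical
  refine ⟨Equiv.prodCongr φ.toEquiv (Equiv.prodCongr φ.toEquiv (Equiv.refl _)), ?_⟩
  rintro ⟨i, j, c⟩ ⟨k, l, c'⟩
  have h : ∀ a b, φ.toEquiv a = φ.toEquiv b ↔ a = b := fun a b => φ.injective.eq_iff
  have h' : ∀ a b, G'.Adj (φ.toEquiv a) (φ.toEquiv b) ↔ G.Adj a b := fun a b => φ.map_adj_iff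
  simp only [Equiv.prodCongr_apply, Prod.map, Equiv.refl_apply,
    gadget_adj_iff _ _ _ _ _ _ _ false false, h, h']

theorem polyTimeReducible_graphIsomorphism (C : FinGraph → Prop)
    (hC : ∀ G, C (gadgetGraph G)) : PolyTimeReducible graphIsomorphism (isoProblem C) := by
  refine ⟨reduction, ⟨computableInPolyTimeReduction⟩, fun p _ => ⟨⟨hC _, hC _⟩, ?_⟩⟩
  constructor
  · rintro ⟨φ⟩
    obtain ⟨ψ⟩ := nonempty_gadget_iso φ
    exact ⟨((gadgetGraphIso p.1).trans ψ).trans (gadgetGraphIso p.2).symm⟩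
  · rintro ⟨φ⟩
    exact nonempty_iso_of_gadget_iso
      (((gadgetGraphIso p.1).symm.trans φ).trans (gadgetGraphIso p.2))

theorem isGIComplete_isoProblem (C : FinGraph → Prop)
    (hC : ∀ G, C (gadgetGraph G)) : IsGIComplete (isoProblem C) :=
  ⟨⟨id, ⟨Turing.idComputableInPolyTime encodePair⟩, fun _ _ => ⟨⟨trivial, trivial⟩, Iff.rfl⟩⟩,
    polyTimeReducible_graphIsomorphism C hC⟩

theorem isProperHGraph_gadgetGraph {W : Type*} (H : SimpleGraph W)
    (hH : ∃ c : H.ConnectedComponent,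
      ¬ c.toSimpleGraph.IsAcyclic ∧ ¬ IsUnicyclic c.toSimpleGraph) (G : FinGraph) :
    IsProperHGraph H (gadgetGraph G).graph := by
  obtain ⟨c, h, h'⟩ := hH
  obtain ⟨S, e, f, hef, heS, hfS, hconn⟩ := exists_two_edges_connected_induce H c h h'
  refine isProperHGraph_of_roles hef heS hfS hconn
    (fun v => role G.graph ((tripleEquiv G.order).symm v)) fun u v => ?_
  rw [← (tripleEquiv G.order).symm.injective.ne_iff]
  rfl

end HGraphs

theorem mainTheorem6 {W : Type*} [Finite W] (H : SimpleGraph W)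
    (hH : ∃ c : H.ConnectedComponent,
      ¬ c.toSimpleGraph.IsAcyclic ∧ ¬ HGraphs.IsUnicyclic c.toSimpleGraph) :
    HGraphs.IsGIComplete (HGraphs.isoProblem fun G => HGraphs.IsProperHGraph H G.graph) ∧
      HGraphs.IsGIComplete (HGraphs.isoProblem fun G => HGraphs.IsHGraph H G.graph) := by
  refine ⟨HGraphs.isGIComplete_isoProblem _ (HGraphs.isProperHGraph_gadgetGraph H hH),
    HGraphs.isGIComplete_isoProblem _ fun G => ?_⟩
  obtain ⟨len, R, -⟩ := HGraphs.isProperHGraph_gadgetGraph H hH G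
  exact ⟨len, ⟨R⟩⟩
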